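/- Let $n,m\ge 0$ be integers and let $B_1,\dots,B_m$ be real orthogonal $n\times n$ matrices with $B_j^{-1}B_k=-B_k^{-1}B_j$ for $j\ne k$. Let $G=\mathbb R^n\times\mathbb R^n\times\mathbb T^m$, $\mathbb T=\mathbb R/2\pi\mathbb Z$, be the reduced Heisenberg group with multidimensional center, with product $$(q,p,t)(q',p',t')=\bigl(q+q',\,p+p',\,t+t'+\tfrac12[z,z']\bigr),\qquad [z,z']_j=q'\cdot B_jp-q\cdot B_jp',$$ where $z=(q,p)$, $z'=(q',p')$ and the last coordinates are taken modulo $2\pi$, and with the measure $d\mu=(2\pi)^{-m}\,dq\,dp\,dt$. Let $\mathbb Z^{m*}=\mathbb Z^m\setminus\{0\}$ carry the measure $\alpha(\{k\})=(2\pi)^{-n}\|k\|_2^n$. For $k\in\mathbb Z^{m*}$ put $B_k=k_1B_1+\dots+k_mB_m$ and let $$\pi_k(q,p,t)\varphi(x)=e^{ik\cdot t}e^{iq\cdot B_k(x+p/2)}\varphi(x+p),\qquad \varphi\in L^2(\mathbb R^n),$$ be the Schrödinger representation. For $f,g$ in the Schwartz space $S(G)$, the Wigner transform is the operator-valued function $$V(f,g)(z,k)=\int_G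 f(w)\,g(w^{-1}z)\,\pi_k(w)\,d\mu(w),\qquad z\in G,\ k\in\mathbb Z^{m*},$$ the integral being taken in the strong sense on $L^2(\mathbb R^n)$. Let $S_2$ denote the class of Hilbert–Schmidt operators, with its Hilbert–Schmidt norm, and let $L^2(G\times\mathbb Z^{m*},S_2,d(\mu\otimes\alpha))$ be the space of measurable operator-valued functions $\sigma$, with values in the bounded operators on $L^2(\mathbb R^n)$, such that $$\|\sigma\|_{2,\mu\otimes\alpha}^2=\int_{G\times\mathbb Z^{m*}}\|\sigma(z,k)\|_{S_2}^2\,d(\mu\otimes\alpha)(z,k)<\infty.$$ **Theorem.** Let $\sigma\in L^2(G\times\mathbb Z^{m*},S_2,d(\mu\otimes\alpha))$. Then there is exactly one bounded operator $W_\sigma$ on $L^2(G,d\mu)$, the Weyl transform of $\sigma$, such that for all $f,g\in S(G)$ $$\int_G (W_\sigma f)\,g\,d\mu=\int_{G\times\mathbb Z^{m*}}\operatorname{tr}\bigl[\sigma(z,k)^*\,V(f,g)(z,k)\bigr]\,d(\mu\otimes\alpha)(z,k),$$ the integral on the right being absolutely convergent. Moreover $W_\sigma$ is a Hilbert–Schmidt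 operator on $L^2(G,d\mu)$, and $$\|W_\sigma\|_{S_2}=\|\sigma\|_{2,\mu\otimes\alpha}.$$ -/

import Mathlib

open MeasureTheory
open scoped ENNReal ComplexConjugate ContDiff InnerProductSpace

noncomputable section

namespace RedHeis

/-! ## Hilbert-Schmidt operators (Schatten class `S₂`) and the trace -/

section HilbertSchmidt

variable {H : Type*} [NormedAddCommGroup H] [InnerProductSpace ℂ H] [CompleteSpace H]

/-- An index set of an orthonormal basis of the Hilbert space `H`. -/
def onbIndex (H : Type*) [NormedAddCommGroup H] [InnerProductSpace ℂ H] [CompleteSpace H] :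
    Set H :=
  (exists_hilbertBasis ℂ H).choose

/-- An orthonormal (Hilbert) basis of `H`. -/
def onb (H : Type*) [NormedAddCommGroup H] [InnerProductSpace ℂ H] [CompleteSpace H] :
    HilbertBasis (onbIndex H) ℂ H :=
  (exists_hilbertBasis ℂ H).choose_spec.choose

/-- `‖A‖²_{S₂} = ∑ᵢ ‖A eᵢ‖²`, with values in `[0, ∞]`. By `hsSq_eq` below it does not depend on the
orthonormal basis. -/
def hsSq (A : H →L[ℂ] H) : ℝ≥0∞ :=
  ∑' i, ‖A (onb H i)‖ₑ ^ 2

/-- The Hilbert-Schmidt norm `‖A‖_{S₂}`, with values in `[0, ∞]`. -/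
def hsNorm (A : H →L[ℂ] H) : ℝ≥0∞ :=
  hsSq A ^ (1 / 2 : ℝ)

/-- `A` is Hilbert-Schmidt, i.e. it belongs to the Schatten-von Neumann class `S₂`. -/
def IsHilbertSchmidt (A : H →L[ℂ] H) : Prop :=
  hsNorm A < ⊤

/-- The trace `tr A = ∑ᵢ ⟨eᵢ, A eᵢ⟩` (meant for trace class operators, such as `A† B` with `A`, `B`
Hilbert-Schmidt). -/
def trace (A : H →L[ℂ] H) : ℂ :=
  ∑' i, ⟪onb H i, A (onb H i)⟫_ℂ

/-- Parseval's identity in `[0, ∞]`. -/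
theorem enorm_sq_eq_tsum {ι : Type*} (b : HilbertBasis ι ℂ H) (x : H) :
    ‖x‖ₑ ^ 2 = ∑' i, ‖⟪b i, x⟫_ℂ‖ₑ ^ 2 := by
  have h1 : HasSum (fun i => ‖b.repr x i‖ ^ 2) (‖x‖ ^ 2) := by
    have := lp.hasSum_norm (p := 2) (by norm_num) (b.repr x)
    simpa using this
  have h2 := h1.tsum_eq
  have e1 : ∀ y : ℂ, ‖y‖ₑ ^ 2 = ENNReal.ofReal (‖y‖ ^ 2) := fun y => by
    rw [ENNReal.ofReal_pow (norm_nonneg _), ofReal_norm]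
  have e2 : ‖x‖ₑ ^ 2 = ENNReal.ofReal (‖x‖ ^ 2) := by
    rw [ENNReal.ofReal_pow (norm_nonneg _), ofReal_norm]
  simp_rw [e1]
  rw [e2, ← h2, ENNReal.ofReal_tsum_of_nonneg (fun _ => by positivity) h1.summable]
  simp_rw [b.repr_apply_apply]

theorem tsum_enorm_sq_adjoint {ι κ : Type*} (b : HilbertBasis ι ℂ H) (c : HilbertBasis κ ℂ H)
    (A : H →L[ℂ] H) :
    ∑' i, ‖A (b i)‖ₑ ^ 2 = ∑' j, ‖ContinuousLinearMap.adjoint A (c j)‖ₑ ^ 2 := by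
  simp_rw [enorm_sq_eq_tsum c (A (b _)),
    enorm_sq_eq_tsum b (ContinuousLinearMap.adjoint A (c _))]
  rw [ENNReal.tsum_comm]
  refine tsum_congr fun j => tsum_congr fun i => ?_
  rw [ContinuousLinearMap.adjoint_inner_right, ← inner_conj_symm, RCLike.enorm_conj]

/-- The Hilbert-Schmidt norm may be computed in any orthonormal basis. -/
theorem hsSq_eq {ι : Type*} (b : HilbertBasis ι ℂ H) (A : H →L[ℂ] H) :
    hsSq A = ∑' i, ‖A (b i)‖ₑ ^ 2 := by
  rw [hsSq, tsum_enorm_sq_adjoint (onb H) (onb H) A, tsum_enorm_sq_adjoint b (onb H) A]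

end HilbertSchmidt

/-! ## The reduced Heisenberg group with multidimensional center -/

/-- `ℝⁿ` with Euclidean norm and Lebesgue measure. -/
abbrev E (n : ℕ) : Type := EuclideanSpace ℝ (Fin n)

/-- The circle `ℝ / 2πℤ`. -/
abbrev Circ : Type := AddCircle (2 * Real.pi)

instance : Fact (0 < 2 * Real.pi) := ⟨Real.two_pi_pos⟩

/-- The family `B₁, …, B_m` of `n × n` matrices: orthogonal, with `B_j⁻¹ B_k = -B_k⁻¹ B_j` for
`j ≠ k`. -/
structure IsAdmissible {n m : ℕ} (B : Fin m → Matrix (Fin n) (Fin n) ℝ) : Prop where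
  orthogonal : ∀ j, B j ∈ Matrix.orthogonalGroup (Fin n) ℝ
  anticomm : ∀ j k, j ≠ k → (B j)⁻¹ * B k = -((B k)⁻¹ * B j)

/-- The bilinear form `x · M y`. -/
def form {n : ℕ} (M : Matrix (Fin n) (Fin n) ℝ) (x y : E n) : ℝ :=
  x.ofLp ⬝ᵥ M.mulVec y.ofLp

theorem form_add_left {n : ℕ} (M : Matrix (Fin n) (Fin n) ℝ) (x x' y : E n) :
    form M (x + x') y = form M x y + form M x' y := by
  simp [form, add_dotProduct]

theorem form_add_right {n : ℕ} (M : Matrix (Fin n) (Fin n) ℝ) (x y y' : E n) :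
    form M x (y + y') = form M x y + form M x y' := by
  simp [form, Matrix.mulVec_add, dotProduct_add]

theorem form_neg_left {n : ℕ} (M : Matrix (Fin n) (Fin n) ℝ) (x y : E n) :
    form M (-x) y = -form M x y := by
  simp [form]

theorem form_neg_right {n : ℕ} (M : Matrix (Fin n) (Fin n) ℝ) (x y : E n) :
    form M x (-y) = -form M x y := by
  simp [form, Matrix.mulVec_neg]

/-- The reduced Heisenberg group `G = ℝⁿ × ℝⁿ × 𝕋ᵐ` attached to `B₁, …, B_m`; its elements are
`(q, p, t)`. -/
structure G {n m : ℕ} (B : Fin m → Matrix (Fin n) (Fin n) ℝ) : Type where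
  q : E n
  p : E n
  t : Fin m → Circ

namespace G

variable {n m : ℕ} {B : Fin m → Matrix (Fin n) (Fin n) ℝ}

@[ext]
theorem ext' {z w : G B} (hq : z.q = w.q) (hp : z.p = w.p) (ht : ∀ j, z.t j = w.t j) : z = w := by
  cases z; cases w
  simp only [G.mk.injEq]
  exact ⟨hq, hp, funext ht⟩

/-- `(x, y, t) (x', y', t') = (x + x', y + y', t + t' + ½ [z, z'])` with
`[z, z']_j = x' · B_j y - x · B_j y'`, the last coordinates being taken modulo `2π`. -/
instance : Mul (G B) where
  mul z w := ⟨z.q + w.q, z.p + w.p, fun j =>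
    z.t j + w.t j + ((1 / 2 * (form (B j) w.q z.p - form (B j) z.q w.p) : ℝ) : Circ)⟩

instance : One (G B) := ⟨⟨0, 0, 0⟩⟩

instance : Inv (G B) := ⟨fun z => ⟨-z.q, -z.p, -z.t⟩⟩

@[simp] theorem mul_q (z w : G B) : (z * w).q = z.q + w.q := rfl
@[simp] theorem mul_p (z w : G B) : (z * w).p = z.p + w.p := rfl
@[simp] theorem mul_t (z w : G B) (j : Fin m) : (z * w).t j =
    z.t j + w.t j + ((1 / 2 * (form (B j) w.q z.p - form (B j) z.q w.p) : ℝ) : Circ) := rfl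
@[simp] theorem one_q : (1 : G B).q = 0 := rfl
@[simp] theorem one_p : (1 : G B).p = 0 := rfl
@[simp] theorem one_t : (1 : G B).t = 0 := rfl
@[simp] theorem inv_q (z : G B) : (z⁻¹).q = -z.q := rfl
@[simp] theorem inv_p (z : G B) : (z⁻¹).p = -z.p := rfl
@[simp] theorem inv_t (z : G B) : (z⁻¹).t = -z.t := rfl

instance : Group (G B) :=
  Group.ofLeftAxioms
    (by
      intro a b c
      ext j
      · simp [add_assoc]
      · simp [add_assoc]
      · simp only [mul_t, mul_q, mul_p, form_add_left, form_add_right]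
        have : ∀ (x y z : Circ) (u v u' v' : ℝ), u + v = u' + v' →
            x + y + (u : Circ) + z + (v : Circ) = x + (y + z + (u' : Circ)) + (v' : Circ) := by
          intro x y z u v u' v' h
          have h' : (u : Circ) + (v : Circ) = (u' : Circ) + (v' : Circ) := by
            rw [← AddCircle.coe_add, ← AddCircle.coe_add, h]
          calc x + y + (u : Circ) + z + (v : Circ)
              = x + y + z + ((u : Circ) + (v : Circ)) := by abel
            _ = x + y + z + ((u' : Circ) + (v' : Circ)) := by rw [h']
            _ = _ := by abel
        apply this
        ring)
    (by
      intro a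
      ext j
      · simp
      · simp
      · simp [form])
    (by
      intro a
      ext j
      · simp
      · simp
      · simp [form_neg_left, form_neg_right])

/-- `G` as the set `ℝⁿ × ℝⁿ × 𝕋ᵐ`. -/
def equivProd (B : Fin m → Matrix (Fin n) (Fin n) ℝ) : G B ≃ E n × E n × (Fin m → Circ) where
  toFun z := (z.q, z.p, z.t)
  invFun z := ⟨z.1, z.2.1, z.2.2⟩
  left_inv _ := rfl
  right_inv _ := rfl

instance : MeasurableSpace (G B) := MeasurableSpace.comap (equivProd B) inferInstance

end G

variable {n m : ℕ} (B : Fin m → Matrix (Fin n) (Fin n) ℝ)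

/-- The measure `dμ(q, p, t) = dq dp dt / (2π)ᵐ` on `G`; here `dt` is the product of the arc
lengths, of total mass `(2π)ᵐ`. -/
def μ : Measure (G B) :=
  ENNReal.ofReal (((2 * Real.pi) ^ m)⁻¹) •
    Measure.map (G.equivProd B).symm (volume : Measure (E n × E n × (Fin m → Circ)))

/-- `ℤ^{m*} = ℤᵐ \ {0}`. -/
abbrev ZStar (m : ℕ) : Type := {k : Fin m → ℤ // k ≠ 0}

/-- `‖k‖₂ = (|k₁|² + ⋯ + |k_m|²)^{1/2}`. -/
def norm2 (k : Fin m → ℤ) : ℝ := Real.sqrt (∑ j, (k j : ℝ) ^ 2)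

/-- The measure `α` on `ℤ^{m*}` with `α({k}) = (2π)⁻ⁿ ‖k‖₂ⁿ`. -/
def α (n m : ℕ) : Measure (ZStar m) :=
  Measure.count.withDensity fun k =>
    ENNReal.ofReal (((2 * Real.pi) ^ n)⁻¹ * norm2 k.1 ^ n)

/-- The Hilbert space `L²(ℝⁿ)`. -/
abbrev L2R (n : ℕ) : Type := Lp ℂ 2 (volume : Measure (E n))

/-- The Hilbert space `L²(G, dμ)`. -/
abbrev L2G : Type := Lp ℂ 2 (μ B)

/-! ## Schrödinger representations and the Wigner transform -/

/-- `B_k = k₁ B₁ + ⋯ + k_m B_m`. -/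
def Bsum (k : Fin m → ℤ) : Matrix (Fin n) (Fin n) ℝ := ∑ j, (k j : ℝ) • B j

/-- The phase `e^{i k·t} e^{i q · B_k (x + p/2)}`. -/
def phase (k : Fin m → ℤ) (z : G B) (x : E n) : ℂ :=
  (∏ j, fourier (k j) (z.t j)) *
    Complex.exp (Complex.I * (form (Bsum B k) z.q (x + (1 / 2 : ℝ) • z.p) : ℝ))

theorem norm_phase (k : Fin m → ℤ) (z : G B) (x : E n) : ‖phase B k z x‖ = 1 := by
  rw [phase, norm_mul, norm_prod, mul_comm Complex.I, Complex.norm_exp_ofReal_mul_I, mul_one]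
  refine Finset.prod_eq_one fun j _ => ?_
  rw [fourier_apply, Circle.norm_coe]

theorem continuous_phase (k : Fin m → ℤ) (z : G B) : Continuous (phase B k z) := by
  unfold phase form
  simp only [dotProduct, Matrix.mulVec]
  fun_prop

theorem memLp_schrodinger (k : Fin m → ℤ) (z : G B) (φ : L2R n) :
    MemLp (fun x => phase B k z x * φ (x + z.p)) 2 volume := by
  have h1 : MemLp (fun x => φ (x + z.p)) 2 (volume : Measure (E n)) :=
    (Lp.memLp φ).comp_measurePreserving (measurePreserving_add_right volume z.p)
  refine h1.of_le ((continuous_phase B k z).aestronglyMeasurable.mul h1.1) ?_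
  exact Filter.Eventually.of_forall fun x => by rw [norm_mul, norm_phase, one_mul]

/-- The Schrödinger representation
`π_k(q, p, t) φ(x) = e^{i k·t} e^{i q · B_k (x + p/2)} φ(x + p)` on `L²(ℝⁿ)`. -/
def schrodinger (k : Fin m → ℤ) (z : G B) : L2R n →ₗᵢ[ℂ] L2R n where
  toFun φ := (memLp_schrodinger B k z φ).toLp
  map_add' φ ψ := by
    rw [← MemLp.toLp_add]
    apply MemLp.toLp_congr
    have h := (measurePreserving_add_right (volume : Measure (E n)) z.p).quasiMeasurePreserving.ae
      (Lp.coeFn_add φ ψ)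
    filter_upwards [h] with x hx
    simp only [Pi.add_apply, hx, mul_add]
  map_smul' c φ := by
    rw [RingHom.id_apply, ← MemLp.toLp_const_smul]
    apply MemLp.toLp_congr
    have h := (measurePreserving_add_right (volume : Measure (E n)) z.p).quasiMeasurePreserving.ae
      (Lp.coeFn_smul c φ)
    filter_upwards [h] with x hx
    simp only [Pi.smul_apply, hx, smul_eq_mul]
    ring
  norm_map' φ := by
    have h := (Lp.aestronglyMeasurable φ)
    have h2 := eLpNorm_comp_measurePreserving (p := 2) h
      (measurePreserving_add_right (volume : Measure (E n)) z.p)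
    simp only [LinearMap.coe_mk, AddHom.coe_mk, Lp.norm_toLp]
    rw [Lp.norm_def, ← h2]
    congr 1
    apply eLpNorm_congr_norm_ae
    exact Filter.Eventually.of_forall fun x => by
      rw [norm_mul, norm_phase, one_mul]; rfl

open Classical in
/-- The group Fourier transform `(ℱ h)(k) φ = ∫_G h(q, p, t) π_k(q, p, t) φ dμ(q, p, t)`,
`φ ∈ L²(ℝⁿ)`, as a bounded operator on `L²(ℝⁿ)`. The integrals (Bochner integrals in `L²(ℝⁿ)`)
converge for every integrable `h`; the value is `0` by convention if they do not. -/
def groupFourier (h : G B → ℂ) (k : Fin m → ℤ) : L2R n →L[ℂ] L2R n :=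
  if hh : ∀ φ : L2R n, Integrable (fun z => h z • schrodinger B k z φ) (μ B) then
    LinearMap.mkContinuous
      { toFun := fun φ => ∫ z, h z • schrodinger B k z φ ∂(μ B)
        map_add' := fun φ ψ => by
          rw [← integral_add (hh φ) (hh ψ)]
          simp only [map_add, smul_add]
        map_smul' := fun c φ => by
          rw [RingHom.id_apply, ← integral_smul]
          simp only [map_smul, smul_comm c] }
      (∫ z, ‖h z‖ ∂(μ B))
      (fun φ => by
        refine (norm_integral_le_integral_norm _).trans_eq ?_
        simp only [norm_smul, LinearIsometry.norm_map]
        rw [integral_mul_const])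
  else 0

/-- The translation `(τ_w f)(z) = f(w⁻¹ z)`. -/
def translate {B : Fin m → Matrix (Fin n) (Fin n) ℝ} (w : G B) (f : G B → ℂ) (z : G B) : ℂ :=
  f (w⁻¹ * z)

/-- The Wigner transform `V(f, g)(z, k) = ∫_G f(w) (τ_w g)(z) π_k(w) dμ(w)`. -/
def wigner (f g : G B → ℂ) (z : G B) (k : ZStar m) : L2R n →L[ℂ] L2R n :=
  groupFourier B (fun w => f w * translate w g z) k.1

/-! ## Symbols, Schwartz functions and the Weyl transform -/

/-- The norm of `L²(G × ℤ^{m*}, S₂, d(μ ⊗ α))`, with values in `[0, ∞]`. -/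
def symbolNorm (σ : G B × ZStar m → (L2R n →L[ℂ] L2R n)) : ℝ≥0∞ :=
  (∫⁻ x, hsNorm (σ x) ^ (2 : ℝ) ∂((μ B).prod (α n m))) ^ (1 / 2 : ℝ)

/-- `σ ∈ L²(G × ℤ^{m*}, S₂, d(μ ⊗ α))`. Measurability is that of all matrix coefficients, which for
maps into the separable Hilbert space `S₂` is the same as strong measurability. -/
structure MemSymbolL2 (σ : G B × ZStar m → (L2R n →L[ℂ] L2R n)) : Prop where
  measurable : ∀ φ ψ : L2R n, AEMeasurable (fun x => ⟪φ, σ x ψ⟫_ℂ) ((μ B).prod (α n m))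
  norm_lt_top : symbolNorm B σ < ⊤

/-- A function on `G`, read as a function on `ℝⁿ × ℝⁿ × ℝᵐ` that is `2π`-periodic in the last `m`
variables. -/
def lift {B : Fin m → Matrix (Fin n) (Fin n) ℝ} (f : G B → ℂ) :
    (E n × E n) × (Fin m → ℝ) → ℂ :=
  fun y => f ⟨y.1.1, y.1.2, fun j => (y.2 j : Circ)⟩

/-- The Schwartz space `S(G)`: smooth functions on `ℝⁿ × ℝⁿ × 𝕋ᵐ`, all of whose derivatives decay
faster than every power of `(q, p)`. -/
structure IsSchwartz {B : Fin m → Matrix (Fin n) (Fin n) ℝ} (f : G B → ℂ) : Prop where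
  smooth : ContDiff ℝ ∞ (lift f)
  decay : ∀ N l : ℕ, ∃ C : ℝ, ∀ y, ‖y.1‖ ^ N * ‖iteratedFDeriv ℝ l (lift f) y‖ ≤ C

/-- The integrand `tr[σ(z, k)* V(f, g)(z, k)]`. -/
def weylIntegrand (σ : G B × ZStar m → (L2R n →L[ℂ] L2R n)) (f g : G B → ℂ)
    (x : G B × ZStar m) : ℂ :=
  trace (ContinuousLinearMap.adjoint (σ x) ∘L wigner B f g x.1 x.2)

/-- `W` is the Weyl transform `W_σ` on `L²(G)`: for all `f, g ∈ S(G)` the integral below converges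
absolutely and
`∫_G (W f) g dμ = ∫_{G × ℤ^{m*}} tr[σ(z, k)* V(f, g)(z, k)] d(μ ⊗ α)(z, k)`. -/
def IsWeylTransform (σ : G B × ZStar m → (L2R n →L[ℂ] L2R n)) (W : L2G B →L[ℂ] L2G B) : Prop :=
  ∀ f g : G B → ℂ, IsSchwartz f → IsSchwartz g →
    Integrable (weylIntegrand B σ f g) ((μ B).prod (α n m)) ∧
    ∀ F : L2G B, F =ᵐ[μ B] f →
      ∫ z, (W F) z * g z ∂(μ B) = ∫ x, weylIntegrand B σ f g x ∂((μ B).prod (α n m))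

end RedHeis

end

/-!
# Weyl transforms on the reduced Heisenberg group with multidimensional center

Everything rests on the Schur orthogonality relations for the matrix coefficients
`⟨ψ, π_k(w) φ⟩` of the Schrödinger representations with `k ≠ 0`
(`integral_conj_coef_mul_coef`): they are square integrable on `G`, those with different `k` are
orthogonal, and for equal `k` their inner products are `α({k})⁻¹` times products of inner products
in `L²(ℝⁿ)`. Indeed, the integral over `𝕋ᵐ` separates the `k`; and for fixed `p` the coefficient is,
up to a phase, the Fourier transform of `x ↦ conj (ψ x) φ(x + p)` at `-(2π)⁻¹ B_kᵀ q`, so that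
Plancherel's theorem in `q` applies. The weight `α({k})` is the Jacobian `(2π)⁻ⁿ |det B_k|`, since
the hypotheses on the `B_j` say that `B_kᵀ B_k = ‖k‖₂² I` (`transpose_Bsum_mul_Bsum`).

Hence, for an orthonormal basis `(e_i)` of `L²(ℝⁿ)`, the functions
`E_a = √α({k}) conj ⟨e_j, π_k e_i⟩` with `a = (k, i, j)` form an orthonormal family in `L²(G)`
(`orthonormal_coefVec`). It is not complete, as `k = 0` is missing, but completeness is not needed.
Up to the factor `√α({k})`, the matrix entries of the Wigner transform `V(f, g)(z, k)` are the inner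
products of `E_a` with the slice at `z` of `Φ(w, z) = f(w) g(w⁻¹ z)` (`sliceInner_twisted`).
If `s_a(z) = √α({k}) ⟨e_j, σ(z, k) e_i⟩`, then the orthogonal sum `L(w, z) = ∑ₐ E_a(w) s_a(z)`
converges in `L²(G × G)` and has the norm of `σ` (`exists_orthogonal_sum`, `lintegral_hsNorm_sq`),
and expanding the trace in matrix entries gives
`∫ tr[σ(z, k)* V(f, g)(z, k)] d(μ ⊗ α) = ⟨L, Φ⟩` (`integral_weylIntegrand`), the convergence being
absolute by the inequalities of Bessel and Cauchy-Schwarz (`lintegral_tsum_slice_lt_top`).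

As `(w, u) ↦ (w, w u)` preserves `μ ⊗ μ`, the number `⟨L, Φ⟩` equals `∫ (W f) g dμ` for the
integral operator `W` with kernel `K(w, u) = conj (L(w, w u))`, and the Hilbert-Schmidt norm of `W`
is the `L²` norm of `K`, hence that of `L` (`hsSq_kernelOp`, `exists_isWeylTransform`). Uniqueness
holds because the Schwartz functions `a(q, p) e^{i k·t}` are total in `L²(G)`
(`ae_eq_zero_of_integral_testFun`, `IsWeylTransform.unique`).
-/

noncomputable section

namespace RedHeis

/-! ### Plancherel's theorem for integrable square integrable functions -/

section Plancherel

open FourierTransform SchwartzMap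

variable {V : Type*} [NormedAddCommGroup V] [InnerProductSpace ℝ V] [FiniteDimensional ℝ V]
  [MeasurableSpace V] [BorelSpace V]

/-- On `L¹ ∩ L²` the Fourier integral represents the `L²` Fourier transform: both define the same
tempered distribution. -/
theorem coeFn_fourier_toLp {u : V → ℂ} (h1 : Integrable u) (h2 : MemLp u 2) :
    (𝓕 (h2.toLp u) : Lp ℂ 2 (volume : Measure V)) =ᵐ[volume] 𝓕 u := by
  have hcont : Continuous (𝓕 u) :=
    VectorFourier.fourierIntegral_continuous Real.continuous_fourierChar
      (by exact continuous_inner) h1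
  have hloc1 : LocallyIntegrable (𝓕 (h2.toLp u) : Lp ℂ 2 (volume : Measure V)) volume :=
    (Lp.memLp _).locallyIntegrable (by norm_num)
  have hloc2 : LocallyIntegrable (𝓕 u) volume := hcont.locallyIntegrable
  have key := ae_eq_zero_of_integral_contDiff_smul_eq_zero (μ := (volume : Measure V))
    (f := fun x => (𝓕 (h2.toLp u) : Lp ℂ 2 (volume : Measure V)) x - 𝓕 u x)
    (hloc1.sub hloc2) ?_
  · filter_upwards [key] with x hx
    exact sub_eq_zero.1 hx
  intro g g_smooth g_cpt
  have hg₁ : HasCompactSupport (Complex.ofRealCLM ∘ g) := g_cpt.comp_left rfl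
  have hg₂ : ContDiff ℝ ∞ (Complex.ofRealCLM ∘ g) := by fun_prop
  set γ : 𝓢(V, ℂ) := hg₁.toSchwartzMap hg₂ with hγ
  have e1 : ∫ x, γ x • (𝓕 (h2.toLp u) : Lp ℂ 2 (volume : Measure V)) x
      = ∫ x, (𝓕 γ) x • u x := by
    rw [← Lp.toTemperedDistribution_apply, ← Lp.fourier_toTemperedDistribution_eq,
      TemperedDistribution.fourier_apply, Lp.toTemperedDistribution_apply]
    refine integral_congr_ae ?_
    filter_upwards [h2.coeFn_toLp] with x hx
    rw [hx]
  have e2 : ∫ x, (𝓕 γ) x • u x = ∫ x, γ x • 𝓕 u x := by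
    have := VectorFourier.integral_fourierIntegral_smul_eq_flip (μ := (volume : Measure V))
      (ν := (volume : Measure V)) (L := innerₗ V) Real.continuous_fourierChar
      (by exact continuous_inner) γ.integrable h1
    rw [flip_innerₗ] at this
    exact this
  have i1 : Integrable (fun x => g x • (𝓕 (h2.toLp u) : Lp ℂ 2 (volume : Measure V)) x) :=
    hloc1.integrable_smul_left_of_hasCompactSupport g_smooth.continuous g_cpt
  have i2 : Integrable (fun x => g x • 𝓕 u x) :=
    hloc2.integrable_smul_left_of_hasCompactSupport g_smooth.continuous g_cpt
  simp only [smul_sub]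
  rw [integral_sub i1 i2, sub_eq_zero]
  have e3 := e1.trans e2
  simpa [hγ] using e3

theorem eLpNorm_fourier {u : V → ℂ} (h1 : Integrable u) (h2 : MemLp u 2) :
    eLpNorm (𝓕 u) 2 = eLpNorm u 2 := by
  rw [← eLpNorm_congr_ae (coeFn_fourier_toLp h1 h2), ← eLpNorm_congr_ae h2.coeFn_toLp,
    ← Lp.enorm_def, ← Lp.enorm_def, ← ofReal_norm, ← ofReal_norm, Lp.norm_fourier_eq]

theorem integral_conj_fourier_mul_fourier {u v : V → ℂ} (hu1 : Integrable u) (hu2 : MemLp u 2)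
    (hv1 : Integrable v) (hv2 : MemLp v 2) :
    ∫ x, conj (𝓕 u x) * 𝓕 v x = ∫ x, conj (u x) * v x := by
  have h := Lp.inner_fourier_eq (hu2.toLp u) (hv2.toLp v)
  rw [L2.inner_def, L2.inner_def] at h
  calc _ = ∫ x, ⟪(𝓕 (hu2.toLp u) : Lp ℂ 2 (volume : Measure V)) x,
            (𝓕 (hv2.toLp v) : Lp ℂ 2 (volume : Measure V)) x⟫_ℂ := by
        refine integral_congr_ae ?_
        filter_upwards [coeFn_fourier_toLp hu1 hu2, coeFn_fourier_toLp hv1 hv2] with x h1 h2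
        rw [h1, h2, RCLike.inner_apply, mul_comm]
    _ = _ := h
    _ = _ := by
        refine integral_congr_ae ?_
        filter_upwards [hu2.coeFn_toLp, hv2.coeFn_toLp] with x h1 h2
        rw [h1, h2, RCLike.inner_apply, mul_comm]

end Plancherel

/-! ### Square integrable functions on product spaces -/

section L2

variable {X Y : Type*} [MeasurableSpace X] [MeasurableSpace Y] {ρ : Measure X} {ν : Measure Y}

theorem eLpNorm_two_sq (f : X → ℂ) : eLpNorm f 2 ρ ^ 2 = ∫⁻ x, ‖f x‖ₑ ^ 2 ∂ρ := by
  simpa using eLpNorm_nnreal_pow_eq_lintegral (p := 2) (f := f) (μ := ρ) (by norm_num)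

theorem enorm_toLp_sq {f : X → ℂ} (hf : MemLp f 2 ρ) :
    ‖hf.toLp f‖ₑ ^ 2 = ∫⁻ x, ‖f x‖ₑ ^ 2 ∂ρ := by
  rw [Lp.enorm_toLp, eLpNorm_two_sq]

theorem enorm_Lp_sq (f : Lp ℂ 2 ρ) : ‖f‖ₑ ^ 2 = ∫⁻ x, ‖f x‖ₑ ^ 2 ∂ρ := by
  rw [Lp.enorm_def, eLpNorm_two_sq]

theorem memLp_two_iff {f : X → ℂ} (hf : AEStronglyMeasurable f ρ) :
    MemLp f 2 ρ ↔ ∫⁻ x, ‖f x‖ₑ ^ 2 ∂ρ < ⊤ := by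
  rw [← eLpNorm_two_sq]
  refine ⟨fun h => ENNReal.pow_lt_top h.2, fun h => ⟨hf, ?_⟩⟩
  by_contra h'
  rw [not_lt, top_le_iff] at h'
  simp [h'] at h

/-- The Cauchy-Schwarz inequality for the unsigned integral. -/
theorem sq_lintegral_mul_le {f g : X → ℝ≥0∞} (hf : AEMeasurable f ρ) (hg : AEMeasurable g ρ) :
    (∫⁻ x, f x * g x ∂ρ) ^ 2 ≤ (∫⁻ x, f x ^ 2 ∂ρ) * ∫⁻ x, g x ^ 2 ∂ρ := by
  have h := ENNReal.lintegral_mul_le_Lp_mul_Lq ρ (Real.HolderConjugate.two_two) hf hg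
  have h2 := pow_le_pow_left' h 2
  refine h2.trans (le_of_eq ?_)
  rw [mul_pow, ← ENNReal.rpow_natCast, ← ENNReal.rpow_natCast, ← ENNReal.rpow_mul,
    ← ENNReal.rpow_mul]
  norm_num

/-- The Cauchy-Schwarz inequality for series in `[0, ∞]`. -/
theorem sq_tsum_mul_le {ι : Type*} (f g : ι → ℝ≥0∞) :
    (∑' i, f i * g i) ^ 2 ≤ (∑' i, f i ^ 2) * ∑' i, g i ^ 2 := by
  let _ : MeasurableSpace ι := ⊤
  have := sq_lintegral_mul_le (ρ := (Measure.count : Measure ι)) (f := f) (g := g)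
    measurable_from_top.aemeasurable measurable_from_top.aemeasurable
  simpa [lintegral_count] using this

theorem lintegral_enorm_sq_tensor [SFinite ν] {f : X → ℂ} {g : Y → ℂ}
    (hf : AEStronglyMeasurable f ρ) (hg : AEStronglyMeasurable g ν) :
    ∫⁻ z, ‖f z.1 * g z.2‖ₑ ^ 2 ∂(ρ.prod ν) = (∫⁻ x, ‖f x‖ₑ ^ 2 ∂ρ) * ∫⁻ y, ‖g y‖ₑ ^ 2 ∂ν := by
  simp only [enorm_mul, mul_pow]
  exact lintegral_prod_mul (hf.enorm.pow_const 2) (hg.enorm.pow_const 2)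

theorem memLp_tensor [SFinite ν] {f : X → ℂ} {g : Y → ℂ} (hf : MemLp f 2 ρ)
    (hg : MemLp g 2 ν) : MemLp (fun z : X × Y => f z.1 * g z.2) 2 (ρ.prod ν) := by
  have hm : AEStronglyMeasurable (fun z : X × Y => f z.1 * g z.2) (ρ.prod ν) :=
    hf.1.comp_fst.mul hg.1.comp_snd
  rw [memLp_two_iff hm, lintegral_enorm_sq_tensor hf.1 hg.1]
  exact ENNReal.mul_lt_top ((memLp_two_iff hf.1).1 hf) ((memLp_two_iff hg.1).1 hg)

theorem memLp_conj {f : X → ℂ} (hf : MemLp f 2 ρ) : MemLp (fun x => conj (f x)) 2 ρ :=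
  hf.star

/-- The isometry `s ↦ e ⊗ s` from `L²(Y)` to `L²(X × Y)`, for a unit vector `e` of `L²(X)`. -/
def tensorLeft [SFinite ν] (e : Lp ℂ 2 ρ) (he : ‖e‖ = 1) :
    Lp ℂ 2 ν →ₗᵢ[ℂ] Lp ℂ 2 (ρ.prod ν) where
  toFun s := (memLp_tensor (Lp.memLp e) (Lp.memLp s)).toLp
  map_add' s t := by
    rw [← MemLp.toLp_add]
    apply MemLp.toLp_congr
    filter_upwards [Measure.quasiMeasurePreserving_snd.ae (Lp.coeFn_add s t)] with z hz
    simp only [Pi.add_apply, hz, mul_add]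
  map_smul' c s := by
    rw [RingHom.id_apply, ← MemLp.toLp_const_smul]
    apply MemLp.toLp_congr
    filter_upwards [Measure.quasiMeasurePreserving_snd.ae (Lp.coeFn_smul c s)] with z hz
    simp only [Pi.smul_apply, hz, smul_eq_mul]
    ring
  norm_map' s := by
    have h : ‖(memLp_tensor (Lp.memLp e) (Lp.memLp s)).toLp‖ₑ ^ 2 = ‖s‖ₑ ^ 2 := by
      rw [enorm_toLp_sq, lintegral_enorm_sq_tensor (Lp.aestronglyMeasurable _)
        (Lp.aestronglyMeasurable _), ← enorm_Lp_sq, ← enorm_Lp_sq, ← ofReal_norm e, he]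
      simp
    have h' := (ENNReal.pow_right_strictMono two_ne_zero).injective h
    simpa [← ofReal_norm] using h'

theorem coeFn_tensorLeft [SFinite ν] (e : Lp ℂ 2 ρ) (he : ‖e‖ = 1) (s : Lp ℂ 2 ν) :
    tensorLeft e he s =ᵐ[ρ.prod ν] fun z => e z.1 * s z.2 :=
  (memLp_tensor (Lp.memLp e) (Lp.memLp s)).coeFn_toLp

/-- The function `y ↦ ⟨e, Φ(·, y)⟩`. For `Φ ∈ L²(X × Y)` almost every slice `Φ(·, y)` is square
integrable; where the integral does not converge, the value is `0` by convention. -/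
def sliceInner (e : Lp ℂ 2 ρ) (Φ : X × Y → ℂ) (y : Y) : ℂ := ∫ x, conj (e x) * Φ (x, y) ∂ρ

theorem ae_memLp_slice [SFinite ρ] [SFinite ν] {Φ : X × Y → ℂ} (hΦ : MemLp Φ 2 (ρ.prod ν)) :
    ∀ᵐ y ∂ν, MemLp (fun x => Φ (x, y)) 2 ρ := by
  have h1 : ∀ᵐ y ∂ν, AEStronglyMeasurable (fun x => Φ (x, y)) ρ :=
    hΦ.1.prod_swap.prodMk_left
  have h2 : ∫⁻ y, ∫⁻ x, ‖Φ (x, y)‖ₑ ^ 2 ∂ρ ∂ν < ⊤ := by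
    rw [← lintegral_prod_symm (fun z => ‖Φ z‖ₑ ^ 2) (hΦ.1.enorm.pow_const 2)]
    exact (memLp_two_iff hΦ.1).1 hΦ
  have h3 := ae_lt_top' (hΦ.1.prod_swap.enorm.pow_const 2).lintegral_prod_right' h2.ne
  filter_upwards [h1, h3] with y h1 h3
  exact (memLp_two_iff h1).2 h3

theorem aestronglyMeasurable_sliceInner [SFinite ρ] [SFinite ν] {Φ : X × Y → ℂ}
    (hΦ : AEStronglyMeasurable Φ (ρ.prod ν)) (e : Lp ℂ 2 ρ) :
    AEStronglyMeasurable (sliceInner e Φ) ν := by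
  have h : AEStronglyMeasurable (fun z : X × Y => conj (e z.1) * Φ z) (ρ.prod ν) :=
    ((Lp.aestronglyMeasurable e).star.comp_fst).mul hΦ
  exact h.prod_swap.integral_prod_right'

theorem sliceInner_eq_inner {Y : Type*} {e : Lp ℂ 2 ρ} {Φ : X × Y → ℂ} {y : Y}
    (h : MemLp (fun x => Φ (x, y)) 2 ρ) : sliceInner e Φ y = ⟪e, h.toLp⟫_ℂ := by
  rw [L2.inner_def, sliceInner]
  refine integral_congr_ae ?_
  filter_upwards [h.coeFn_toLp] with x hx
  rw [hx, RCLike.inner_apply, mul_comm]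

/-- Bessel's inequality, slice by slice. -/
theorem tsum_enorm_sliceInner_sq_le {Y ι : Type*} {e : ι → Lp ℂ 2 ρ} (he : Orthonormal ℂ e)
    {Φ : X × Y → ℂ} {y : Y} (h : MemLp (fun x => Φ (x, y)) 2 ρ) :
    ∑' a, ‖sliceInner (e a) Φ y‖ₑ ^ 2 ≤ ∫⁻ x, ‖Φ (x, y)‖ₑ ^ 2 ∂ρ := by
  rw [← enorm_toLp_sq h]
  simp_rw [sliceInner_eq_inner h]
  have e1 : ∀ z : ℂ, ‖z‖ₑ ^ 2 = ENNReal.ofReal (‖z‖ ^ 2) := fun z => by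
    rw [ENNReal.ofReal_pow (norm_nonneg _), ofReal_norm]
  rw [← ofReal_norm (h.toLp), ← ENNReal.ofReal_pow (norm_nonneg _)]
  simp_rw [e1]
  rw [← ENNReal.ofReal_tsum_of_nonneg (fun _ => by positivity)
    (he.inner_products_summable _)]
  exact ENNReal.ofReal_le_ofReal (he.tsum_inner_products_le _)

theorem sliceInner_congr_ae [SFinite ρ] [SFinite ν] (e : Lp ℂ 2 ρ) {Φ Ψ : X × Y → ℂ}
    (h : Φ =ᵐ[ρ.prod ν] Ψ) : sliceInner e Φ =ᵐ[ν] sliceInner e Ψ := by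
  have h' : ∀ᵐ y ∂ν, ∀ᵐ x ∂ρ, Φ (x, y) = Ψ (x, y) :=
    Measure.ae_ae_of_ae_prod (Measure.measurePreserving_swap.quasiMeasurePreserving.ae h)
  filter_upwards [h'] with y hy
  refine integral_congr_ae ?_
  filter_upwards [hy] with x hx
  rw [hx]

theorem inner_tensorLeft [SFinite ρ] [SFinite ν] (e : Lp ℂ 2 ρ) (he : ‖e‖ = 1) (s : Lp ℂ 2 ν)
    (Φ : Lp ℂ 2 (ρ.prod ν)) :
    ⟪tensorLeft e he s, Φ⟫_ℂ = ∫ y, conj (s y) * sliceInner e Φ y ∂ν := by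
  have hi := L2.integrable_inner (𝕜 := ℂ) (tensorLeft e he s) Φ
  have hc : (fun z => ⟪tensorLeft e he s z, Φ z⟫_ℂ) =ᵐ[ρ.prod ν]
      fun z => conj (s z.2) * (conj (e z.1) * Φ z) := by
    filter_upwards [coeFn_tensorLeft e he s] with z hz
    rw [hz, RCLike.inner_apply, map_mul]
    ring
  rw [L2.inner_def, integral_congr_ae hc, integral_prod_symm _ (hi.congr hc)]
  refine integral_congr_ae (Filter.Eventually.of_forall fun y => ?_)
  simp only [sliceInner]
  rw [← integral_const_mul]

/-- For orthonormal `eₐ` the subspaces `eₐ ⊗ L²(Y)` of `L²(X × Y)` are mutually orthogonal. -/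
theorem orthogonalFamily_tensorLeft [SFinite ρ] [SFinite ν] {ι : Type*} {e : ι → Lp ℂ 2 ρ}
    (he : Orthonormal ℂ e) :
    OrthogonalFamily ℂ (fun _ : ι => Lp ℂ 2 ν) (fun a => tensorLeft (e a) (he.1 a)) := by
  intro a b hab s t
  have hi := L2.integrable_inner (𝕜 := ℂ) (tensorLeft (e a) (he.1 a) s)
    (tensorLeft (e b) (he.1 b) t)
  have hc : (fun z => ⟪tensorLeft (e a) (he.1 a) s z, tensorLeft (e b) (he.1 b) t z⟫_ℂ)
      =ᵐ[ρ.prod ν] fun z => ⟪e a z.1, e b z.1⟫_ℂ * ⟪s z.2, t z.2⟫_ℂ := by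
    filter_upwards [coeFn_tensorLeft (e a) (he.1 a) s, coeFn_tensorLeft (e b) (he.1 b) t]
      with z hz hz'
    rw [hz, hz']
    simp only [RCLike.inner_apply, map_mul]
    ring
  rw [L2.inner_def, integral_congr_ae hc]
  have := integral_prod_mul (μ := ρ) (ν := ν) (fun x => ⟪e a x, e b x⟫_ℂ)
    (fun y => ⟪s y, t y⟫_ℂ)
  rw [this, ← L2.inner_def, he.2 hab, zero_mul]

/-- The orthogonal sum `∑ₐ eₐ ⊗ sₐ` in `L²(X × Y)` exists as soon as `∑ₐ ‖sₐ‖² < ∞`. -/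
theorem exists_orthogonal_sum [SFinite ρ] [SFinite ν] {ι : Type*} {e : ι → Lp ℂ 2 ρ}
    (he : Orthonormal ℂ e) {s : ι → Lp ℂ 2 ν} (hs : ∑' a, ‖s a‖ₑ ^ 2 < ⊤) :
    ∃ L : Lp ℂ 2 (ρ.prod ν), HasSum (fun a => tensorLeft (e a) (he.1 a) (s a)) L ∧
      ‖L‖ₑ ^ 2 = ∑' a, ‖s a‖ₑ ^ 2 := by
  have e1 : ∀ a, ‖s a‖ₑ ^ 2 = ENNReal.ofReal (‖s a‖ ^ 2) := fun a => by
    rw [ENNReal.ofReal_pow (norm_nonneg _), ofReal_norm]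
  have hsum : Summable fun a => ‖s a‖ ^ 2 := by
    have := ENNReal.summable_toReal hs.ne
    refine this.congr fun a => ?_
    rw [e1, ENNReal.toReal_ofReal (by positivity)]
  have hmem : Memℓp s 2 := by
    rw [memℓp_gen_iff (by norm_num)]
    simpa using hsum
  let S : lp (fun _ : ι => Lp ℂ 2 ν) 2 := ⟨s, hmem⟩
  let O := orthogonalFamily_tensorLeft (ν := ν) he
  refine ⟨O.linearIsometry S, O.hasSum_linearIsometry S, ?_⟩
  have h2 : HasSum (fun a => ‖s a‖ ^ 2) (‖S‖ ^ 2) := by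
    have := lp.hasSum_norm (p := 2) (by norm_num) S
    simpa using this
  rw [← ofReal_norm, LinearIsometry.norm_map, ← ENNReal.ofReal_pow (norm_nonneg _), ← h2.tsum_eq,
    ENNReal.ofReal_tsum_of_nonneg (fun _ => by positivity) hsum]
  exact tsum_congr fun a => (e1 a).symm

/-- Absolute convergence of the expansion of `⟨L, Φ⟩` in slices. -/
theorem lintegral_tsum_slice_lt_top [SFinite ρ] [SFinite ν] {ι : Type*} [Countable ι]
    {e : ι → Lp ℂ 2 ρ} (he : Orthonormal ℂ e) {s : ι → Y → ℂ}
    (hsm : ∀ a, AEStronglyMeasurable (s a) ν) (hs : ∑' a, ∫⁻ y, ‖s a y‖ₑ ^ 2 ∂ν < ⊤)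
    {Φ : X × Y → ℂ} (hΦ : MemLp Φ 2 (ρ.prod ν)) :
    ∫⁻ y, ∑' a, ‖s a y‖ₑ * ‖sliceInner (e a) Φ y‖ₑ ∂ν < ⊤ := by
  have m1 : ∀ a, AEMeasurable (fun y => ‖s a y‖ₑ ^ 2) ν := fun a => (hsm a).enorm.pow_const 2
  have m2 : ∀ a, AEMeasurable (fun y => ‖sliceInner (e a) Φ y‖ₑ ^ 2) ν :=
    fun a => (aestronglyMeasurable_sliceInner hΦ.1 (e a)).enorm.pow_const 2
  set F : Y → ℝ≥0∞ := fun y => (∑' a, ‖s a y‖ₑ ^ 2) ^ (1 / 2 : ℝ) with hF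
  set H : Y → ℝ≥0∞ := fun y => (∑' a, ‖sliceInner (e a) Φ y‖ₑ ^ 2) ^ (1 / 2 : ℝ) with hH
  have sqrt_sq : ∀ c : ℝ≥0∞, (c ^ (1 / 2 : ℝ)) ^ 2 = c := fun c => by
    rw [← ENNReal.rpow_natCast, ← ENNReal.rpow_mul]; norm_num
  -- Cauchy-Schwarz in `a` for fixed `y`, then in `y`; Bessel's inequality bounds the second factor
  have hle : ∀ y, ∑' a, ‖s a y‖ₑ * ‖sliceInner (e a) Φ y‖ₑ ≤ F y * H y := fun y => by
    refine (ENNReal.pow_right_strictMono two_ne_zero).le_iff_le.1 ?_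
    simp only [hF, hH, mul_pow, sqrt_sq]
    exact sq_tsum_mul_le _ _
  refine (lintegral_mono hle).trans_lt ?_
  have hcs := sq_lintegral_mul_le (ρ := ν) (f := F) (g := H)
    ((AEMeasurable.tsum m1).pow_const _) ((AEMeasurable.tsum m2).pow_const _)
  simp only [hF, hH, sqrt_sq] at hcs
  have b1 : ∫⁻ y, ∑' a, ‖s a y‖ₑ ^ 2 ∂ν < ⊤ := by
    rwa [lintegral_tsum m1]
  have b2 : ∫⁻ y, ∑' a, ‖sliceInner (e a) Φ y‖ₑ ^ 2 ∂ν < ⊤ := by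
    refine lt_of_le_of_lt (lintegral_mono_ae (g := fun y => ∫⁻ x, ‖Φ (x, y)‖ₑ ^ 2 ∂ρ) ?_) ?_
    · filter_upwards [ae_memLp_slice hΦ] with y hy
      exact tsum_enorm_sliceInner_sq_le he hy
    · rw [← lintegral_prod_symm (fun z => ‖Φ z‖ₑ ^ 2) (hΦ.1.enorm.pow_const 2)]
      exact (memLp_two_iff hΦ.1).1 hΦ
  have := hcs.trans_lt (ENNReal.mul_lt_top b1 b2)
  by_contra h'
  rw [not_lt, top_le_iff] at h'
  rw [h'] at this
  simp at this

end L2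

/-! ### Integral operators with square integrable kernel -/

section Kernel

variable {X : Type*} [MeasurableSpace X] {ρ : Measure X} [SFinite ρ] {K : X × X → ℂ}

theorem enorm_integral_kernel_sq_le {X : Type*} [MeasurableSpace X] {ρ : Measure X}
    {K : X × X → ℂ} {u : X} (hu : MemLp (fun w => K (w, u)) 2 ρ) (f : Lp ℂ 2 ρ) :
    ‖∫ w, K (w, u) * f w ∂ρ‖ₑ ^ 2 ≤ (∫⁻ w, ‖K (w, u)‖ₑ ^ 2 ∂ρ) * ‖f‖ₑ ^ 2 := by
  have h1 : ‖∫ w, K (w, u) * f w ∂ρ‖ₑ ≤ ∫⁻ w, ‖K (w, u)‖ₑ * ‖f w‖ₑ ∂ρ := by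
    refine (enorm_integral_le_lintegral_enorm _).trans_eq ?_
    simp only [enorm_mul]
  refine (pow_le_pow_left' h1 2).trans ?_
  rw [enorm_Lp_sq]
  exact sq_lintegral_mul_le hu.1.enorm (Lp.aestronglyMeasurable f).enorm

theorem aestronglyMeasurable_integral_kernel (hK : MemLp K 2 (ρ.prod ρ)) (f : Lp ℂ 2 ρ) :
    AEStronglyMeasurable (fun u => ∫ w, K (w, u) * f w ∂ρ) ρ := by
  have h : AEStronglyMeasurable (fun z : X × X => K z * f z.1) (ρ.prod ρ) :=
    hK.1.mul (Lp.aestronglyMeasurable f).comp_fst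
  exact h.prod_swap.integral_prod_right'

theorem lintegral_integral_kernel_sq_le (hK : MemLp K 2 (ρ.prod ρ)) (f : Lp ℂ 2 ρ) :
    ∫⁻ u, ‖∫ w, K (w, u) * f w ∂ρ‖ₑ ^ 2 ∂ρ ≤ (∫⁻ z, ‖K z‖ₑ ^ 2 ∂(ρ.prod ρ)) * ‖f‖ₑ ^ 2 := by
  rw [lintegral_prod_symm (fun z => ‖K z‖ₑ ^ 2) (hK.1.enorm.pow_const 2),
    ← lintegral_mul_const' _ _ (by simp)]
  refine lintegral_mono_ae ?_
  filter_upwards [ae_memLp_slice hK] with u hu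
  exact enorm_integral_kernel_sq_le hu f

theorem memLp_integral_kernel (hK : MemLp K 2 (ρ.prod ρ)) (f : Lp ℂ 2 ρ) :
    MemLp (fun u => ∫ w, K (w, u) * f w ∂ρ) 2 ρ := by
  rw [memLp_two_iff (aestronglyMeasurable_integral_kernel hK f)]
  refine (lintegral_integral_kernel_sq_le hK f).trans_lt
    (ENNReal.mul_lt_top ((memLp_two_iff hK.1).1 hK) ?_)
  simp

/-- The integral operator `(T f)(u) = ∫ K(w, u) f(w) dρ(w)` on `L²(ρ)` with kernel
`K ∈ L²(ρ ⊗ ρ)`. -/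
def kernelOp (hK : MemLp K 2 (ρ.prod ρ)) : Lp ℂ 2 ρ →L[ℂ] Lp ℂ 2 ρ :=
  LinearMap.mkContinuous
    { toFun := fun f => (memLp_integral_kernel hK f).toLp
      map_add' := fun f g => by
        rw [← MemLp.toLp_add]
        apply MemLp.toLp_congr
        filter_upwards [ae_memLp_slice hK] with u hu
        simp only [Pi.add_apply]
        have i1 : ∀ f : Lp ℂ 2 ρ, Integrable (fun w => K (w, u) * f w) ρ :=
          fun f => hu.integrable_mul (Lp.memLp f)
        rw [← integral_add (i1 f) (i1 g)]
        refine integral_congr_ae ?_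
        filter_upwards [Lp.coeFn_add f g] with w hw
        rw [hw, Pi.add_apply, mul_add]
      map_smul' := fun c f => by
        rw [RingHom.id_apply, ← MemLp.toLp_const_smul]
        apply MemLp.toLp_congr
        refine Filter.Eventually.of_forall fun u => ?_
        simp only [Pi.smul_apply]
        rw [← integral_smul]
        refine integral_congr_ae ?_
        filter_upwards [Lp.coeFn_smul c f] with w hw
        rw [hw, Pi.smul_apply, mul_smul_comm] }
    (eLpNorm K 2 (ρ.prod ρ)).toReal
    (fun f => by
      have h : ‖(memLp_integral_kernel hK f).toLp‖ₑ ≤ eLpNorm K 2 (ρ.prod ρ) * ‖f‖ₑ := by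
        refine (ENNReal.pow_right_strictMono two_ne_zero).le_iff_le.1 ?_
        rw [enorm_toLp_sq, mul_pow, eLpNorm_two_sq]
        exact lintegral_integral_kernel_sq_le hK f
      have h2 := ENNReal.toReal_mono (ENNReal.mul_ne_top hK.2.ne (by simp)) h
      simpa [ENNReal.toReal_mul] using h2)

theorem coeFn_kernelOp (hK : MemLp K 2 (ρ.prod ρ)) (f : Lp ℂ 2 ρ) :
    kernelOp hK f =ᵐ[ρ] fun u => ∫ w, K (w, u) * f w ∂ρ :=
  (memLp_integral_kernel hK f).coeFn_toLp

theorem integral_kernelOp_mul (hK : MemLp K 2 (ρ.prod ρ)) (f : Lp ℂ 2 ρ) {g : X → ℂ}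
    (hg : MemLp g 2 ρ) :
    ∫ u, kernelOp hK f u * g u ∂ρ = ∫ z, K z * (f z.1 * g z.2) ∂(ρ.prod ρ) := by
  have hi : Integrable (fun z : X × X => K z * (f z.1 * g z.2)) (ρ.prod ρ) :=
    hK.integrable_mul (memLp_tensor (Lp.memLp f) hg)
  rw [integral_prod_symm _ hi]
  refine integral_congr_ae ?_
  filter_upwards [coeFn_kernelOp hK f] with u hu
  rw [hu, ← integral_mul_const]
  simp only [mul_assoc]

/-- An integral operator with kernel in `L²` is Hilbert-Schmidt, its Hilbert-Schmidt norm being the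
`L²` norm of the kernel: apply Parseval's identity to `K(·, u)` for almost every `u`. -/
theorem hsSq_kernelOp [Countable (onbIndex (Lp ℂ 2 ρ))] (hK : MemLp K 2 (ρ.prod ρ)) :
    hsSq (kernelOp hK) = ∫⁻ z, ‖K z‖ₑ ^ 2 ∂(ρ.prod ρ) := by
  have h1 : ∀ i, ‖kernelOp hK (onb (Lp ℂ 2 ρ) i)‖ₑ ^ 2
      = ∫⁻ u, ‖∫ w, K (w, u) * onb (Lp ℂ 2 ρ) i w ∂ρ‖ₑ ^ 2 ∂ρ := fun i => by
    rw [enorm_Lp_sq]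
    refine lintegral_congr_ae ?_
    filter_upwards [coeFn_kernelOp hK (onb (Lp ℂ 2 ρ) i)] with u hu
    rw [hu]
  rw [hsSq]
  simp_rw [h1]
  rw [← lintegral_tsum fun i =>
      (aestronglyMeasurable_integral_kernel hK (onb (Lp ℂ 2 ρ) i)).enorm.pow_const 2,
    lintegral_prod_symm (fun z => ‖K z‖ₑ ^ 2) (hK.1.enorm.pow_const 2)]
  refine lintegral_congr_ae ?_
  filter_upwards [ae_memLp_slice hK] with u hu
  have hu' := memLp_conj hu
  have h2 := enorm_sq_eq_tsum (onb (Lp ℂ 2 ρ)) hu'.toLp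
  rw [enorm_toLp_sq] at h2
  simp only [RCLike.enorm_conj] at h2
  rw [h2]
  refine tsum_congr fun i => ?_
  rw [L2.inner_def, ← RCLike.enorm_conj, ← integral_conj]
  congr 2
  refine integral_congr_ae ?_
  filter_upwards [hu'.coeFn_toLp] with w hw
  rw [hw, RCLike.inner_apply]
  simp

end Kernel

/-! ### Separability and weak measurability -/

section Separable

variable {H : Type*} [NormedAddCommGroup H] [InnerProductSpace ℂ H] [CompleteSpace H]

/-- In a separable Hilbert space the balls of radius `1/2` around the basis vectors are disjoint,
so that there are only countably many of them. -/
theorem countable_onbIndex [TopologicalSpace.SeparableSpace H] : Countable (onbIndex H) := by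
  refine Pairwise.countable_of_isOpen_disjoint
    (s := fun i : onbIndex H => Metric.ball (onb H i) (1 / 2)) ?_ (fun _ => Metric.isOpen_ball)
    (fun i => ⟨onb H i, by simp⟩)
  intro i j hij
  refine Metric.ball_disjoint_ball ?_
  have h0 : ⟪onb H i, onb H j⟫_ℂ = 0 := (onb H).orthonormal.2 hij
  have h1 : ‖onb H i - onb H j‖ ^ 2 = 2 := by
    rw [@norm_sub_sq ℂ, h0, (onb H).orthonormal.1 i, (onb H).orthonormal.1 j]
    norm_num
  rw [dist_eq_norm]
  nlinarith [norm_nonneg (onb H i - onb H j)]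

/-- Weakly measurable functions into a separable Hilbert space are strongly measurable: they are
limits of the partial sums of their expansions in an orthonormal basis. -/
theorem stronglyMeasurable_of_inner {X : Type*} [MeasurableSpace X] [Countable (onbIndex H)]
    {f : X → H} (hf : ∀ i, Measurable fun x => ⟪onb H i, f x⟫_ℂ) : StronglyMeasurable f := by
  refine stronglyMeasurable_of_tendsto (Filter.atTop : Filter (Finset (onbIndex H)))
    (f := fun s x => ∑ i ∈ s, ⟪onb H i, f x⟫_ℂ • onb H i) (fun s => ?_) ?_
  · refine Finset.stronglyMeasurable_fun_sum s fun i _ => ?_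
    exact (hf i).stronglyMeasurable.smul_const _
  · rw [tendsto_pi_nhds]
    intro x
    have := (onb H).hasSum_repr (f x)
    simp only [HilbertBasis.repr_apply_apply] at this
    exact this

instance countable_onbIndex_Lp {X : Type*} [MeasurableSpace X] (ρ : Measure X)
    [IsSeparable ρ] : Countable (onbIndex (Lp ℂ 2 ρ)) := by
  have : Fact ((2 : ℝ≥0∞) ≠ ⊤) := ⟨ENNReal.ofNat_ne_top⟩
  exact countable_onbIndex

end Separable

/-! ### Measure theory on the reduced Heisenberg group -/

section Group

theorem continuous_form {n : ℕ} (M : Matrix (Fin n) (Fin n) ℝ) :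
    Continuous fun x : E n × E n => form M x.1 x.2 := by
  unfold form
  simp only [dotProduct, Matrix.mulVec]
  fun_prop

variable {n m : ℕ} {B : Fin m → Matrix (Fin n) (Fin n) ℝ}

theorem measurable_form {X : Type*} [MeasurableSpace X] (M : Matrix (Fin n) (Fin n) ℝ)
    {f g : X → E n} (hf : Measurable f) (hg : Measurable g) :
    Measurable fun x => form M (f x) (g x) :=
  (continuous_form M).measurable.comp (hf.prodMk hg)

variable (B) in
/-- `G` and `ℝⁿ × ℝⁿ × 𝕋ᵐ` as measurable spaces. -/
def coords : G B ≃ᵐ E n × E n × (Fin m → Circ) where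
  toEquiv := G.equivProd B
  measurable_toFun := comap_measurable _
  measurable_invFun := measurable_comap_iff.2 measurable_id

theorem measurable_q : Measurable (G.q : G B → E n) := measurable_fst.comp (coords B).measurable

theorem measurable_p : Measurable (G.p : G B → E n) :=
  (measurable_fst.comp measurable_snd).comp (coords B).measurable

theorem measurable_t : Measurable (G.t : G B → Fin m → Circ) :=
  (measurable_snd.comp measurable_snd).comp (coords B).measurable

theorem measurable_mk {X : Type*} [MeasurableSpace X] {q p : X → E n} {t : X → Fin m → Circ}
    (hq : Measurable q) (hp : Measurable p) (ht : Measurable t) :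
    Measurable fun x => (⟨q x, p x, t x⟩ : G B) :=
  (coords B).symm.measurable.comp (hq.prodMk (hp.prodMk ht))

instance : MeasurableMul₂ (G B) where
  measurable_mul := by
    have h1 : Measurable fun x : G B × G B => x.1.q := measurable_q.comp measurable_fst
    have h2 : Measurable fun x : G B × G B => x.1.p := measurable_p.comp measurable_fst
    have h3 : Measurable fun x : G B × G B => x.2.q := measurable_q.comp measurable_snd
    have h4 : Measurable fun x : G B × G B => x.2.p := measurable_p.comp measurable_snd
    refine measurable_mk (h1.add h3) (h2.add h4) (measurable_pi_lambda _ fun j => ?_)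
    have h5 : Measurable fun x : G B × G B => x.1.t j :=
      (measurable_pi_apply j).comp (measurable_t.comp measurable_fst)
    have h6 : Measurable fun x : G B × G B => x.2.t j :=
      (measurable_pi_apply j).comp (measurable_t.comp measurable_snd)
    refine (h5.add h6).add (AddCircle.measurable_mk'.comp ?_)
    exact ((measurable_form _ h3 h2).sub (measurable_form _ h1 h4)).const_mul _

instance : MeasurableInv (G B) where
  measurable_inv := measurable_mk measurable_q.neg measurable_p.neg measurable_t.neg

instance : MeasurableSpace.CountablyGenerated (G B) :=
  MeasurableSpace.CountablyGenerated.comap _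

/-- The normalization `(2π)⁻ᵐ` of the measure on `G`. -/
def normConst (m : ℕ) : ℝ≥0∞ :=
  ENNReal.ofReal (((2 * Real.pi) ^ m)⁻¹)

theorem normConst_ne_zero : normConst m ≠ 0 := by
  simp only [normConst, ne_eq, ENNReal.ofReal_eq_zero, not_le]
  positivity

theorem normConst_ne_top : normConst m ≠ ⊤ := ENNReal.ofReal_ne_top

theorem lintegral_mu (f : G B → ℝ≥0∞) :
    ∫⁻ z, f z ∂(μ B) = normConst m * ∫⁻ x, f ((coords B).symm x) := by
  rw [μ, lintegral_smul_measure, smul_eq_mul]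
  congr 1
  exact lintegral_map_equiv f (coords B).symm

theorem integral_mu (f : G B → ℂ) :
    ∫ z, f z ∂(μ B) = (((2 * Real.pi) ^ m)⁻¹ : ℝ) • ∫ x, f ((coords B).symm x) := by
  rw [μ, integral_smul_measure, ENNReal.toReal_ofReal (by positivity)]
  congr 1
  exact integral_map_equiv (coords B).symm f

theorem integrable_mu_iff {f : G B → ℂ} :
    Integrable f (μ B) ↔ Integrable fun x => f ((coords B).symm x) := by
  have h := integrable_smul_measure (f := f) (normConst_ne_zero (m := m)) normConst_ne_top
    (μ := Measure.map (G.equivProd B).symm (volume : Measure (E n × E n × (Fin m → Circ))))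
  refine h.trans ?_
  exact integrable_map_equiv (coords B).symm f

instance : SigmaFinite (μ B) := by
  have h : SigmaFinite (Measure.map (G.equivProd B).symm
      (volume : Measure (E n × E n × (Fin m → Circ)))) :=
    (coords B).symm.sigmaFinite_map
  exact inferInstanceAs (SigmaFinite (Real.toNNReal (((2 * Real.pi) ^ m)⁻¹) •
    Measure.map (G.equivProd B).symm (volume : Measure (E n × E n × (Fin m → Circ)))))

instance : (μ B).IsMulLeftInvariant where
  map_mul_left_eq_self z := by
    -- left translation is a skew product: a translation in `q`, for fixed `q` a translation in `p`,
    -- and for fixed `q` and `p` a translation in `t`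
    let g : E n → E n × (Fin m → Circ) → E n × (Fin m → Circ) := fun q y =>
      (z.p + y.1, fun j => z.t j + y.2 j +
        ((1 / 2 * (form (B j) q z.p - form (B j) z.q y.1) : ℝ) : Circ))
    have hgm : Measurable (Function.uncurry g) := by
      have h1 : Measurable fun x : E n × E n × (Fin m → Circ) => x.2.1 := by fun_prop
      refine (h1.const_add z.p).prodMk (measurable_pi_lambda _ fun j => ?_)
      have h2 : Measurable fun x : E n × E n × (Fin m → Circ) => x.2.2 j := by fun_prop
      refine (h2.const_add (z.t j)).add (AddCircle.measurable_mk'.comp ?_)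
      exact ((measurable_form _ measurable_fst measurable_const).sub
        (measurable_form _ measurable_const h1)).const_mul _
    have hg : ∀ q, MeasurePreserving (g q) := fun q => by
      refine (measurePreserving_add_left volume z.p).skew_product (μc := volume) (μd := volume)
        (g := fun p (t : Fin m → Circ) j => z.t j + t j +
          ((1 / 2 * (form (B j) q z.p - form (B j) z.q p) : ℝ) : Circ)) ?_
          (Filter.Eventually.of_forall fun p => ?_)
      · exact (measurable_snd.comp (hgm.comp (measurable_prodMk_left (x := q))))
      · have : (fun (t : Fin m → Circ) j => z.t j + t j +
            ((1 / 2 * (form (B j) q z.p - form (B j) z.q p) : ℝ) : Circ)) = fun t =>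
            (fun j => z.t j +
              ((1 / 2 * (form (B j) q z.p - form (B j) z.q p) : ℝ) : Circ)) + t := by
          funext t j
          simp only [Pi.add_apply]
          abel
        rw [this]
        exact map_add_left_eq_self _ _
    have hT : MeasurePreserving (fun x : E n × E n × (Fin m → Circ) => (z.q + x.1, g x.1 x.2)) :=
      (measurePreserving_add_left volume z.q).skew_product hgm
        (Filter.Eventually.of_forall fun q => (hg q).map_eq)
    have hc : (fun w : G B => z * w) ∘ (coords B).symm
        = (coords B).symm ∘ fun x : E n × E n × (Fin m → Circ) => (z.q + x.1, g x.1 x.2) := rfl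
    rw [μ, Measure.map_smul]
    congr 1
    change Measure.map (fun w : G B => z * w) (Measure.map (coords B).symm volume)
      = Measure.map (coords B).symm volume
    rw [Measure.map_map (measurable_const_mul z) (coords B).symm.measurable, hc,
      ← Measure.map_map (coords B).symm.measurable hT.measurable, hT.map_eq]

end Group

/-! ### Matrix coefficients of the Schrödinger representations -/

section Coefficients

variable {n m : ℕ} (B : Fin m → Matrix (Fin n) (Fin n) ℝ)

theorem measurable_phase (k : Fin m → ℤ) :
    Measurable fun x : G B × E n => phase B k x.1 x.2 := by
  unfold phase
  have h1 : Measurable fun x : G B × E n => x.1.q := measurable_q.comp measurable_fst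
  have h2 : Measurable fun x : G B × E n => x.1.p := measurable_p.comp measurable_fst
  refine Measurable.mul (Finset.measurable_fun_prod _ fun j _ => ?_) ?_
  · exact (fourier (k j)).continuous.measurable.comp
      ((measurable_pi_apply j).comp (measurable_t.comp measurable_fst))
  · refine Complex.measurable_exp.comp (Measurable.const_mul ?_ _)
    exact Complex.measurable_ofReal.comp
      (measurable_form _ h1 (measurable_snd.add (h2.const_smul (1 / 2 : ℝ))))

theorem coeFn_schrodinger (k : Fin m → ℤ) (z : G B) (φ : L2R n) :
    schrodinger B k z φ =ᵐ[volume] fun x => phase B k z x * φ (x + z.p) :=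
  (memLp_schrodinger B k z φ).coeFn_toLp

/-- The matrix coefficient `⟨ψ, π_k(z) φ⟩`. -/
def coef (k : Fin m → ℤ) (φ ψ : L2R n) (z : G B) : ℂ := ⟪ψ, schrodinger B k z φ⟫_ℂ

theorem coef_eq_integral (k : Fin m → ℤ) (φ ψ : L2R n) (z : G B) :
    coef B k φ ψ z = ∫ x, phase B k z x * (conj (ψ x) * φ (x + z.p)) := by
  rw [coef, L2.inner_def]
  refine integral_congr_ae ?_
  filter_upwards [coeFn_schrodinger B k z φ] with x hx
  rw [hx, RCLike.inner_apply]
  ring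

theorem measurable_coef (k : Fin m → ℤ) (φ ψ : L2R n) : Measurable (coef B k φ ψ) := by
  have h : StronglyMeasurable fun x : G B × E n =>
      phase B k x.1 x.2 * (conj (ψ x.2) * φ (x.2 + x.1.p)) := by
    refine (measurable_phase B k).stronglyMeasurable.mul (StronglyMeasurable.mul ?_ ?_)
    · exact ((Lp.stronglyMeasurable ψ).comp_measurable measurable_snd).star
    · exact (Lp.stronglyMeasurable φ).comp_measurable
        (measurable_snd.add (measurable_p.comp measurable_fst))
  have h2 := (h.integral_prod_right' (ν := volume)).measurable
  convert h2 using 1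
  funext z
  exact coef_eq_integral B k φ ψ z

theorem stronglyMeasurable_schrodinger (k : Fin m → ℤ) (φ : L2R n) :
    StronglyMeasurable fun z => schrodinger B k z φ :=
  stronglyMeasurable_of_inner fun i => measurable_coef B k φ (onb _ i)

theorem integrable_smul_schrodinger {h : G B → ℂ} (hh : Integrable h (μ B)) (k : Fin m → ℤ)
    (φ : L2R n) : Integrable (fun z => h z • schrodinger B k z φ) (μ B) := by
  refine (hh.norm.mul_const ‖φ‖).mono'
    (hh.1.smul (stronglyMeasurable_schrodinger B k φ).aestronglyMeasurable) ?_
  exact Filter.Eventually.of_forall fun z => by rw [norm_smul, LinearIsometry.norm_map]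

/-- For integrable `h` the group Fourier transform is the weak integral of `h π_k`, so that its
matrix entries are integrals against the matrix coefficients of `π_k`. -/
theorem inner_groupFourier {h : G B → ℂ} (hh : Integrable h (μ B)) (k : Fin m → ℤ)
    (φ ψ : L2R n) :
    ⟪ψ, groupFourier B h k φ⟫_ℂ = ∫ z, h z * coef B k φ ψ z ∂(μ B) := by
  have h1 : groupFourier B h k φ = ∫ z, h z • schrodinger B k z φ ∂(μ B) := by
    rw [groupFourier, dif_pos fun φ => integrable_smul_schrodinger B hh k φ]
    rfl
  rw [h1, ← integral_inner (integrable_smul_schrodinger B hh k φ) ψ]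
  simp only [inner_smul_right, coef]

end Coefficients

/-! ### The matrices `B_k` and the characters of the torus -/

section Matrices

variable {n m : ℕ} {B : Fin m → Matrix (Fin n) (Fin n) ℝ}

/-- The anticommutation relations say that `B_kᵀ B_k = ‖k‖₂² I`. -/
theorem transpose_Bsum_mul_Bsum (hB : IsAdmissible B) (k : Fin m → ℤ) :
    (Bsum B k).transpose * Bsum B k = (∑ j, (k j : ℝ) ^ 2) • (1 : Matrix (Fin n) (Fin n) ℝ) := by
  have horth : ∀ j, (B j).transpose * B j = 1 := fun j =>
    (Matrix.mem_orthogonalGroup_iff' (Fin n) ℝ).1 (hB.orthogonal j)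
  have hinv : ∀ j, (B j)⁻¹ = (B j).transpose := fun j => Matrix.inv_eq_left_inv (horth j)
  set S : Matrix (Fin n) (Fin n) ℝ :=
    ∑ j, ∑ l, ((k j : ℝ) * k l) • ((B j).transpose * B l) with hS
  have h1 : (Bsum B k).transpose * Bsum B k = S := by
    simp only [hS, Bsum, Matrix.transpose_sum, Matrix.transpose_smul, Finset.sum_mul,
      Finset.mul_sum, Finset.smul_sum, smul_mul_assoc, mul_smul_comm, smul_smul]
    rw [Finset.sum_comm]
    refine Finset.sum_congr rfl fun j _ => Finset.sum_congr rfl fun l _ => ?_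
    rw [mul_comm]
  have h2 : S = ∑ j, ∑ l, ((k j : ℝ) * k l) • ((B l).transpose * B j) := by
    rw [hS, Finset.sum_comm]
    refine Finset.sum_congr rfl fun j _ => Finset.sum_congr rfl fun l _ => ?_
    rw [mul_comm]
  -- in `S + S` the terms with `j ≠ l` cancel by anticommutation
  have h3 : S + S = (2 : ℝ) • (∑ j, (k j : ℝ) ^ 2) • (1 : Matrix (Fin n) (Fin n) ℝ) := by
    nth_rewrite 2 [h2]
    rw [hS, ← Finset.sum_add_distrib, Finset.sum_smul, Finset.smul_sum]
    refine Finset.sum_congr rfl fun j _ => ?_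
    rw [← Finset.sum_add_distrib, Finset.sum_eq_single j]
    · rw [horth j, ← add_smul, smul_smul]
      congr 1
      ring
    · intro l _ hl
      have := hB.anticomm j l hl.symm
      rw [hinv, hinv] at this
      rw [this, smul_neg, neg_add_cancel]
    · simp
  rw [h1]
  have h4 : (2 : ℝ) • S = (2 : ℝ) • (∑ j, (k j : ℝ) ^ 2) • (1 : Matrix (Fin n) (Fin n) ℝ) := by
    rw [two_smul, h3]
  exact smul_right_injective _ two_ne_zero h4

theorem norm2_pos {k : Fin m → ℤ} (hk : k ≠ 0) : 0 < norm2 k := by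
  obtain ⟨j, hj⟩ := Function.ne_iff.1 hk
  refine Real.sqrt_pos.2 (Finset.sum_pos' (fun _ _ => sq_nonneg _) ⟨j, Finset.mem_univ j, ?_⟩)
  have : (k j : ℝ) ≠ 0 := by exact_mod_cast hj
  positivity

theorem abs_det_Bsum (hB : IsAdmissible B) (k : Fin m → ℤ) : |(Bsum B k).det| = norm2 k ^ n := by
  have h := congrArg Matrix.det (transpose_Bsum_mul_Bsum hB k)
  rw [Matrix.det_mul, Matrix.det_transpose, Matrix.det_smul, Matrix.det_one, mul_one,
    Fintype.card_fin] at h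
  rw [← Real.sqrt_mul_self_eq_abs, h, norm2]
  have h0 : (0 : ℝ) ≤ ∑ j, (k j : ℝ) ^ 2 := Finset.sum_nonneg fun _ _ => sq_nonneg _
  rw [← Real.sq_sqrt h0, ← pow_mul, mul_comm 2 n, pow_mul, Real.sqrt_sq (by positivity),
    Real.sqrt_sq (by positivity)]

/-- The weight `(2π)⁻ⁿ ‖k‖₂ⁿ` of the point `k`. -/
def weight (n : ℕ) {m : ℕ} (k : Fin m → ℤ) : ℝ := ((2 * Real.pi) ^ n)⁻¹ * norm2 k ^ n

theorem weight_pos {k : Fin m → ℤ} (hk : k ≠ 0) : 0 < weight n k := by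
  have := norm2_pos hk
  unfold weight
  positivity

/-- The dual variable `-(2π)⁻¹ B_kᵀ q`: in terms of it the phase `e^{i q · B_k x}` is the kernel
`e^{-2πi x · ξ}` of the Fourier transform. -/
def freq (B : Fin m → Matrix (Fin n) (Fin n) ℝ) (k : Fin m → ℤ) : E n →ₗ[ℝ] E n :=
  Matrix.toLpLin 2 2 ((-(2 * Real.pi)⁻¹) • (Bsum B k).transpose)

theorem abs_det_freq (hB : IsAdmissible B) (k : Fin m → ℤ) :
    |LinearMap.det (freq B k)| = weight n k := by
  rw [freq, Matrix.toLpLin_eq_toLin, LinearMap.det_toLin, Matrix.det_smul, Matrix.det_transpose,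
    abs_mul, abs_det_Bsum hB, Fintype.card_fin, abs_pow, abs_neg, abs_inv,
    abs_of_pos Real.two_pi_pos, weight, inv_pow]

theorem inner_freq (k : Fin m → ℤ) (q x : E n) :
    -2 * Real.pi * ⟪x, freq B k q⟫_ℝ = form (Bsum B k) q x := by
  have h : ⟪x, freq B k q⟫_ℝ = -(2 * Real.pi)⁻¹ * form (Bsum B k) q x := by
    rw [freq, Matrix.toLpLin_apply, EuclideanSpace.inner_eq_star_dotProduct, form,
      Matrix.smul_mulVec, smul_dotProduct, smul_eq_mul, Matrix.mulVec_transpose,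
      Matrix.dotProduct_mulVec]
    simp
  rw [h]
  have := Real.pi_ne_zero
  field_simp

/-- The character `t ↦ e^{i k·t}` of the torus `𝕋ᵐ`. -/
def char (k : Fin m → ℤ) (t : Fin m → Circ) : ℂ := ∏ j, fourier (k j) (t j)

theorem continuous_char (k : Fin m → ℤ) : Continuous (char k) := by
  unfold char
  fun_prop

theorem norm_char (k : Fin m → ℤ) (t : Fin m → Circ) : ‖char k t‖ = 1 := by
  rw [char, norm_prod]
  refine Finset.prod_eq_one fun j _ => ?_
  rw [fourier_apply, Circle.norm_coe]

theorem volume_univ_torus : volume (Set.univ : Set (Fin m → Circ))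
    = ENNReal.ofReal ((2 * Real.pi) ^ m) := by
  rw [← Set.pi_univ, volume_pi_pi]
  simp only [AddCircle.measure_univ, Finset.prod_const, Finset.card_univ, Fintype.card_fin]
  rw [ENNReal.ofReal_pow Real.two_pi_pos.le]

theorem integral_conj_fourier_mul (a b : ℤ) :
    ∫ t : Circ, conj (fourier a t) * fourier b t =
      if a = b then ((2 * Real.pi : ℝ) : ℂ) else 0 := by
  have h := orthonormal_iff_ite.1 (orthonormal_fourier (T := 2 * Real.pi)) a b
  rw [ContinuousMap.inner_toLp] at h
  rw [AddCircle.volume_eq_smul_haarAddCircle, integral_smul_measure,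
    ENNReal.toReal_ofReal Real.two_pi_pos.le]
  simp only [mul_comm (conj _)]
  rw [h]
  split_ifs <;> simp

theorem integral_conj_char_mul_char (k l : Fin m → ℤ) :
    ∫ t, conj (char k t) * char l t = if k = l then (((2 * Real.pi) ^ m : ℝ) : ℂ) else 0 := by
  simp only [char, map_prod, ← Finset.prod_mul_distrib]
  rw [integral_fintype_prod_volume_eq_prod
    (f := fun j (t : Circ) => conj (fourier (k j) t) * fourier (l j) t)]
  simp only [integral_conj_fourier_mul]
  split_ifs with h
  · subst h
    simp
  · obtain ⟨j, hj⟩ := Function.ne_iff.1 h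
    exact Finset.prod_eq_zero (Finset.mem_univ j) (by simp [hj])

end Matrices

/-! ### Schur orthogonality for the Schrödinger representations -/

section Schur

open FourierTransform

variable {n m : ℕ} {B : Fin m → Matrix (Fin n) (Fin n) ℝ}

/-- The function `x ↦ conj (ψ x) φ(x + p)`, whose Fourier transform gives the matrix
coefficients. -/
def corr (φ ψ : L2R n) (p x : E n) : ℂ := conj (ψ x) * φ (x + p)

theorem stronglyMeasurable_corr (φ ψ : L2R n) :
    StronglyMeasurable fun y : E n × E n => corr φ ψ y.1 y.2 := by
  refine StronglyMeasurable.mul ?_ ?_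
  · exact ((Lp.stronglyMeasurable ψ).comp_measurable measurable_snd).star
  · exact (Lp.stronglyMeasurable φ).comp_measurable (measurable_snd.add measurable_fst)

theorem integrable_corr (φ ψ : L2R n) (p : E n) : Integrable (corr φ ψ p) := by
  have h1 : MemLp (fun x => φ (x + p)) 2 (volume : Measure (E n)) :=
    (Lp.memLp φ).comp_measurePreserving (measurePreserving_add_right volume p)
  exact (memLp_conj (Lp.memLp ψ)).integrable_mul h1

theorem lintegral_enorm_corr_sq (φ ψ : L2R n) :
    ∫⁻ p, ∫⁻ x, ‖corr φ ψ p x‖ₑ ^ 2 = ‖ψ‖ₑ ^ 2 * ‖φ‖ₑ ^ 2 := by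
  have hm : Measurable fun y : E n × E n => ‖corr φ ψ y.1 y.2‖ₑ ^ 2 :=
    (stronglyMeasurable_corr φ ψ).enorm.pow_const 2
  rw [lintegral_lintegral_swap hm.aemeasurable, enorm_Lp_sq, enorm_Lp_sq,
    ← lintegral_mul_const' _ _ (by rw [← enorm_Lp_sq]; simp)]
  refine lintegral_congr fun x => ?_
  simp only [corr, enorm_mul, mul_pow, RCLike.enorm_conj]
  rw [lintegral_const_mul' _ _ (by simp),
    lintegral_add_left_eq_self (fun y => ‖φ y‖ₑ ^ 2) x]

theorem ae_memLp_corr (φ ψ : L2R n) : ∀ᵐ p : E n, MemLp (corr φ ψ p) 2 := by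
  have hm : Measurable fun y : E n × E n => ‖corr φ ψ y.1 y.2‖ₑ ^ 2 :=
    (stronglyMeasurable_corr φ ψ).enorm.pow_const 2
  have hfin : ∫⁻ p, ∫⁻ x, ‖corr φ ψ p x‖ₑ ^ 2 ≠ ⊤ := by
    rw [lintegral_enorm_corr_sq]
    exact ENNReal.mul_ne_top (by simp) (by simp)
  filter_upwards [ae_lt_top hm.lintegral_prod_right' hfin] with p hp
  exact (memLp_two_iff (integrable_corr φ ψ p).1).2 hp

theorem integral_conj_corr_mul_corr (φ ψ φ' ψ' : L2R n) :
    ∫ p, ∫ x, conj (corr φ ψ p x) * corr φ' ψ' p x = ⟪ψ', ψ⟫_ℂ * ⟪φ, φ'⟫_ℂ := by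
  have i1 : Integrable fun x => ⟪ψ' x, ψ x⟫_ℂ := L2.integrable_inner ψ' ψ
  have i2 : Integrable fun x => ⟪φ x, φ' x⟫_ℂ := L2.integrable_inner φ φ'
  have e1 : ∀ p x, conj (corr φ ψ p x) * corr φ' ψ' p x
      = ⟪ψ' x, ψ x⟫_ℂ * ⟪φ (x + p), φ' (x + p)⟫_ℂ := fun p x => by
    simp only [corr, RCLike.inner_apply, map_mul, Complex.conj_conj]
    ring
  have hint : Integrable (fun y : E n × E n =>
      ⟪ψ' y.1, ψ y.1⟫_ℂ * ⟪φ (y.1 + y.2), φ' (y.1 + y.2)⟫_ℂ) (volume.prod volume) :=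
    (measurePreserving_prod_add (volume : Measure (E n)) volume).integrable_comp_of_integrable
      (i1.mul_prod i2)
  simp only [e1]
  rw [integral_integral_swap (f := fun p x => ⟪ψ' x, ψ x⟫_ℂ * ⟪φ (x + p), φ' (x + p)⟫_ℂ) hint.swap,
    L2.inner_def, L2.inner_def, ← integral_mul_const]
  refine integral_congr_ae (Filter.Eventually.of_forall fun x => ?_)
  simp only
  rw [integral_const_mul, integral_add_left_eq_self (fun y => ⟪φ y, φ' y⟫_ℂ) x]

theorem coef_eq_char_mul (k : Fin m → ℤ) (φ ψ : L2R n) (q p : E n) (t : Fin m → Circ) :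
    coef B k φ ψ ⟨q, p, t⟩ = char k t * coef B k φ ψ ⟨q, p, 0⟩ := by
  rw [coef_eq_integral, coef_eq_integral, ← integral_const_mul]
  refine integral_congr_ae (Filter.Eventually.of_forall fun x => ?_)
  simp only [phase, char, Pi.zero_apply, fourier_eval_zero, Finset.prod_const_one]
  ring

/-- Up to a phase factor not depending on `φ` and `ψ`, the matrix coefficient at `(q, p, 0)` is the
Fourier transform of `x ↦ conj (ψ x) φ(x + p)`. -/
theorem coef_eq_fourier (k : Fin m → ℤ) (φ ψ : L2R n) (q p : E n) :
    coef B k φ ψ ⟨q, p, 0⟩ =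
      Complex.exp ((form (Bsum B k) q ((1 / 2 : ℝ) • p) : ℝ) * Complex.I) *
        𝓕 (corr φ ψ p) (freq B k q) := by
  rw [coef_eq_integral, Real.fourier_eq', ← integral_const_mul]
  refine integral_congr_ae (Filter.Eventually.of_forall fun x => ?_)
  simp only [phase, Pi.zero_apply, fourier_eval_zero, Finset.prod_const_one, one_mul, inner_freq,
    smul_eq_mul, corr]
  rw [← mul_assoc (Complex.exp _) (Complex.exp _), ← Complex.exp_add, form_add_right]
  congr 2
  push_cast
  ring

theorem continuous_fourier_corr (φ ψ : L2R n) (p : E n) : Continuous (𝓕 (corr φ ψ p)) :=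
  VectorFourier.fourierIntegral_continuous Real.continuous_fourierChar
    (by exact continuous_inner) (integrable_corr φ ψ p)

theorem map_freq (hB : IsAdmissible B) {k : Fin m → ℤ} (hk : k ≠ 0) :
    Measure.map (freq B k) volume
      = ENNReal.ofReal (weight n k)⁻¹ • (volume : Measure (E n)) := by
  have h0 : LinearMap.det (freq B k) ≠ 0 := by
    intro h
    have := abs_det_freq hB k
    rw [h, abs_zero] at this
    exact (weight_pos (n := n) hk).ne this
  rw [Measure.map_linearMap_addHaar_eq_smul_addHaar volume h0, abs_inv, abs_det_freq hB]

theorem measurable_freq (k : Fin m → ℤ) : Measurable (freq B k) :=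
  (LinearMap.continuous_of_finiteDimensional (freq B k)).measurable

theorem lintegral_enorm_coef_sq_slice (hB : IsAdmissible B) {k : Fin m → ℤ} (hk : k ≠ 0)
    {φ ψ : L2R n} {p : E n} (hp : MemLp (corr φ ψ p) 2) :
    ∫⁻ q, ‖coef B k φ ψ ⟨q, p, 0⟩‖ₑ ^ 2
      = ENNReal.ofReal (weight n k)⁻¹ * ∫⁻ x, ‖corr φ ψ p x‖ₑ ^ 2 := by
  have e1 : ∀ q, ‖coef B k φ ψ ⟨q, p, 0⟩‖ₑ ^ 2 = ‖𝓕 (corr φ ψ p) (freq B k q)‖ₑ ^ 2 := fun q => by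
    rw [coef_eq_fourier, enorm_mul, ← ofReal_norm (Complex.exp _), Complex.norm_exp_ofReal_mul_I,
      ENNReal.ofReal_one, one_mul]
  simp only [e1]
  rw [← lintegral_map (f := fun ξ => ‖𝓕 (corr φ ψ p) ξ‖ₑ ^ 2)
      ((continuous_fourier_corr φ ψ p).enorm.measurable.pow_const 2) (measurable_freq k),
    map_freq hB hk, lintegral_smul_measure, ← eLpNorm_two_sq,
    eLpNorm_fourier (integrable_corr φ ψ p) hp, eLpNorm_two_sq, smul_eq_mul]

theorem integral_conj_coef_mul_coef_slice (hB : IsAdmissible B) {k : Fin m → ℤ} (hk : k ≠ 0)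
    {φ ψ φ' ψ' : L2R n} {p : E n} (hp : MemLp (corr φ ψ p) 2) (hp' : MemLp (corr φ' ψ' p) 2) :
    ∫ q, conj (coef B k φ ψ ⟨q, p, 0⟩) * coef B k φ' ψ' ⟨q, p, 0⟩
      = ((weight n k)⁻¹ : ℝ) • ∫ x, conj (corr φ ψ p x) * corr φ' ψ' p x := by
  have e1 : ∀ q, conj (coef B k φ ψ ⟨q, p, 0⟩) * coef B k φ' ψ' ⟨q, p, 0⟩
      = conj (𝓕 (corr φ ψ p) (freq B k q)) * 𝓕 (corr φ' ψ' p) (freq B k q) := fun q => by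
    rw [coef_eq_fourier, coef_eq_fourier, map_mul]
    have h1 : ∀ θ : ℝ, conj (Complex.exp (θ * Complex.I)) * Complex.exp (θ * Complex.I) = 1 := by
      intro θ
      rw [← Complex.normSq_eq_conj_mul_self, Complex.normSq_eq_norm_sq,
        Complex.norm_exp_ofReal_mul_I]
      simp
    rw [mul_mul_mul_comm, h1, one_mul]
  have hc : Continuous fun ξ => conj (𝓕 (corr φ ψ p) ξ) * 𝓕 (corr φ' ψ' p) ξ :=
    (Complex.continuous_conj.comp (continuous_fourier_corr φ ψ p)).mul
      (continuous_fourier_corr φ' ψ' p)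
  simp only [e1]
  rw [← integral_map (f := fun ξ => conj (𝓕 (corr φ ψ p) ξ) * 𝓕 (corr φ' ψ' p) ξ)
      (measurable_freq k).aemeasurable hc.aestronglyMeasurable, map_freq hB hk,
    integral_smul_measure, ENNReal.toReal_ofReal (inv_nonneg.2 (weight_pos hk).le),
    integral_conj_fourier_mul_fourier (integrable_corr φ ψ p) hp (integrable_corr φ' ψ' p) hp']

theorem measurable_coef_zero (k : Fin m → ℤ) (φ ψ : L2R n) :
    Measurable fun y : E n × E n => coef B k φ ψ ⟨y.1, y.2, 0⟩ :=
  (measurable_coef B k φ ψ).comp (measurable_mk measurable_fst measurable_snd measurable_const)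

theorem memLp_coef (hB : IsAdmissible B) {k : Fin m → ℤ} (hk : k ≠ 0) (φ ψ : L2R n) :
    MemLp (coef B k φ ψ) 2 (μ B) := by
  rw [memLp_two_iff (measurable_coef B k φ ψ).aestronglyMeasurable, lintegral_mu]
  refine ENNReal.mul_lt_top (lt_top_iff_ne_top.2 normConst_ne_top) ?_
  have hm := measurable_coef_zero (B := B) k φ ψ
  have e1 : ∀ x : E n × E n × (Fin m → Circ), ‖coef B k φ ψ ((coords B).symm x)‖ₑ ^ 2
      = ‖coef B k φ ψ ⟨x.1, x.2.1, 0⟩‖ₑ ^ 2 := fun x => by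
    change ‖coef B k φ ψ ⟨x.1, x.2.1, x.2.2⟩‖ₑ ^ 2 = _
    rw [coef_eq_char_mul, enorm_mul, ← ofReal_norm (char k _), norm_char, ENNReal.ofReal_one,
      one_mul]
  have hm1 : Measurable fun x : E n × E n × (Fin m → Circ) =>
      ‖coef B k φ ψ ⟨x.1, x.2.1, 0⟩‖ₑ ^ 2 :=
    (hm.comp (measurable_fst.prodMk (measurable_fst.comp measurable_snd))).enorm.pow_const 2
  simp only [e1]
  rw [Measure.volume_eq_prod, lintegral_prod _ hm1.aemeasurable]
  have e2 : ∀ q : E n, ∫⁻ y : E n × (Fin m → Circ), ‖coef B k φ ψ ⟨q, y.1, 0⟩‖ₑ ^ 2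
      = (∫⁻ p, ‖coef B k φ ψ ⟨q, p, 0⟩‖ₑ ^ 2) * ENNReal.ofReal ((2 * Real.pi) ^ m) := fun q => by
    have h := lintegral_prod_mul (μ := (volume : Measure (E n)))
      (ν := (volume : Measure (Fin m → Circ)))
      (f := fun p => ‖coef B k φ ψ ⟨q, p, 0⟩‖ₑ ^ 2) (g := fun _ => 1)
      ((hm.comp (measurable_prodMk_left (x := q))).enorm.pow_const 2).aemeasurable
      aemeasurable_const
    rw [Measure.volume_eq_prod]
    simpa [volume_univ_torus] using h
  simp only [e2]
  rw [lintegral_mul_const' _ _ ENNReal.ofReal_ne_top]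
  refine ENNReal.mul_lt_top ?_ ENNReal.ofReal_lt_top
  rw [lintegral_lintegral_swap (f := fun q p => ‖coef B k φ ψ ⟨q, p, 0⟩‖ₑ ^ 2)
    (hm.enorm.pow_const 2).aemeasurable]
  have e3 : (fun p => ∫⁻ q, ‖coef B k φ ψ ⟨q, p, 0⟩‖ₑ ^ 2) =ᵐ[volume]
      fun p => ENNReal.ofReal (weight n k)⁻¹ * ∫⁻ x, ‖corr φ ψ p x‖ₑ ^ 2 := by
    filter_upwards [ae_memLp_corr φ ψ] with p hp
    exact lintegral_enorm_coef_sq_slice hB hk hp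
  rw [lintegral_congr_ae e3, lintegral_const_mul' _ _ ENNReal.ofReal_ne_top,
    lintegral_enorm_corr_sq]
  exact ENNReal.mul_lt_top ENNReal.ofReal_lt_top (ENNReal.mul_lt_top (by simp) (by simp))

/-- The Schur orthogonality relations: the integral over `𝕋ᵐ` separates different `k`, and for
equal `k` Plancherel's theorem in `q` reduces the integral to that of `conj (corr φ ψ) corr φ' ψ'`;
the weight is the Jacobian of `q ↦ -(2π)⁻¹ B_kᵀ q`. -/
theorem integral_conj_coef_mul_coef (hB : IsAdmissible B) {k l : Fin m → ℤ} (hk : k ≠ 0)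
    (hl : l ≠ 0) (φ ψ φ' ψ' : L2R n) :
    ∫ z, conj (coef B k φ ψ z) * coef B l φ' ψ' z ∂(μ B) =
      if k = l then (((weight n k)⁻¹ : ℝ) : ℂ) * (⟪ψ', ψ⟫_ℂ * ⟪φ, φ'⟫_ℂ) else 0 := by
  have hint : Integrable (fun z => conj (coef B k φ ψ z) * coef B l φ' ψ' z) (μ B) :=
    (memLp_conj (memLp_coef hB hk φ ψ)).integrable_mul (memLp_coef hB hl φ' ψ')
  have hint' := integrable_mu_iff.1 hint
  set F : E n → E n → ℂ := fun q p =>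
    conj (coef B k φ ψ ⟨q, p, 0⟩) * coef B l φ' ψ' ⟨q, p, 0⟩ with hF
  have e1 : ∀ x : E n × E n × (Fin m → Circ),
      conj (coef B k φ ψ ((coords B).symm x)) * coef B l φ' ψ' ((coords B).symm x)
      = F x.1 x.2.1 * (conj (char k x.2.2) * char l x.2.2) := fun x => by
    change conj (coef B k φ ψ ⟨x.1, x.2.1, x.2.2⟩) * coef B l φ' ψ' ⟨x.1, x.2.1, x.2.2⟩ = _
    rw [coef_eq_char_mul k, coef_eq_char_mul l, map_mul, hF]
    ring
  have hint'' : Integrable (fun x : E n × E n × (Fin m → Circ) =>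
      F x.1 x.2.1 * (conj (char k x.2.2) * char l x.2.2)) (volume.prod volume) := by
    simp only [e1] at hint'
    exact hint'
  rw [integral_mu]
  simp only [e1]
  rw [Measure.volume_eq_prod, integral_prod _ hint'']
  have e2 : ∀ q : E n, ∫ y : E n × (Fin m → Circ), F q y.1 * (conj (char k y.2) * char l y.2)
      = (∫ p, F q p) * ∫ t, conj (char k t) * char l t := fun q =>
    integral_prod_mul (μ := (volume : Measure (E n))) (ν := (volume : Measure (Fin m → Circ)))
      (F q) (fun t => conj (char k t) * char l t)
  simp only [e2, integral_conj_char_mul_char]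
  split_ifs with h
  swap
  · simp
  subst h
  -- for `k = l` the integrand does not depend on `t`, so `F` is integrable along with it
  have hFint : Integrable (Function.uncurry F) (volume.prod volume) := by
    have ec : ∀ t, conj (char k t) * char k t = 1 := fun t => by
      rw [← Complex.normSq_eq_conj_mul_self, Complex.normSq_eq_norm_sq, norm_char]
      simp
    simp only [ec, mul_one] at hint''
    have hassoc := (measurePreserving_prodAssoc (volume : Measure (E n)) (volume : Measure (E n))
      (volume : Measure (Fin m → Circ))).integrable_comp_of_integrable hint''
    exact Integrable.of_comp_fst (f := Function.uncurry F) hassoc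
      (by
        intro h0
        have := volume_univ_torus (m := m)
        rw [h0] at this
        simp only [Measure.coe_zero, Pi.zero_apply] at this
        exact (ENNReal.ofReal_pos.2 (by positivity)).ne this)
  rw [integral_mul_const, integral_integral_swap hFint]
  have e3 : (fun p => ∫ q, F q p) =ᵐ[volume]
      fun p => ((weight n k)⁻¹ : ℝ) • ∫ x, conj (corr φ ψ p x) * corr φ' ψ' p x := by
    filter_upwards [ae_memLp_corr φ ψ, ae_memLp_corr φ' ψ'] with p hp hp'
    exact integral_conj_coef_mul_coef_slice hB hk hp hp'
  rw [integral_congr_ae e3, integral_smul, integral_conj_corr_mul_corr]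
  have h2 : ((2 * Real.pi : ℝ) : ℂ) ^ m ≠ 0 :=
    pow_ne_zero _ (by exact_mod_cast Real.two_pi_pos.ne')
  simp only [Complex.real_smul]
  push_cast at h2 ⊢
  field_simp

end Schur

/-! ### Completeness of the characters of the torus -/

section Torus

variable {m : ℕ}

theorem char_neg (k : Fin m → ℤ) (t : Fin m → Circ) : char (-k) t = conj (char k t) := by
  simp only [char, Pi.neg_apply, fourier_neg, map_prod]

/-- The rescaling of `(ℝ/2πℤ)ᵐ` to `(ℝ/ℤ)ᵐ`. -/
def torusHomeo (m : ℕ) : (Fin m → Circ) ≃ₜ UnitAddTorus (Fin m) :=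
  Homeomorph.piCongrRight fun _ =>
    AddCircle.homeomorphAddCircle (2 * Real.pi) 1 Real.two_pi_pos.ne' one_ne_zero

theorem mFourier_torusHomeo (k : Fin m → ℤ) (t : Fin m → Circ) :
    UnitAddTorus.mFourier k (torusHomeo m t) = char k t := by
  simp only [UnitAddTorus.mFourier, ContinuousMap.coe_mk, char]
  refine Finset.prod_congr rfl fun j _ => ?_
  change fourier (k j) (AddCircle.homeomorphAddCircle (2 * Real.pi) 1 _ _ (t j)) = _
  induction t j using QuotientAddGroup.induction_on with
  | _ x =>
    erw [AddCircle.homeomorphAddCircle_apply_mk, fourier_coe_apply, fourier_coe_apply]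
    congr 1
    have := Real.pi_ne_zero
    push_cast
    field_simp

/-- Square integrable functions on the torus are determined by their Fourier coefficients. -/
theorem ae_eq_zero_of_integral_char_mul {f : (Fin m → Circ) → ℂ} (hf : MemLp f 2)
    (h : ∀ k, ∫ t, char k t * f t = 0) : f =ᵐ[volume] 0 := by
  let R : C(UnitAddTorus (Fin m), ℂ) →L[ℂ] C(Fin m → Circ, ℂ) :=
    { toFun := fun g => g.comp (torusHomeo m)
      map_add' := fun _ _ => rfl
      map_smul' := fun _ _ => rfl
      cont := ContinuousMap.continuous_precomp (⟨torusHomeo m, (torusHomeo m).continuous⟩ :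
        C(Fin m → Circ, UnitAddTorus (Fin m))) }
  have hR : Function.Surjective R := fun g => ⟨g.comp (torusHomeo m).symm, by
    ext t
    change g ((torusHomeo m).symm (torusHomeo m t)) = g t
    rw [Homeomorph.symm_apply_apply]⟩
  have hd : DenseRange (ContinuousMap.toLp (E := ℂ) 2 (volume : Measure (Fin m → Circ)) ℂ) :=
    ContinuousMap.toLp_denseRange ℂ volume ℂ ENNReal.ofNat_ne_top
  let J := (ContinuousMap.toLp (E := ℂ) 2 (volume : Measure (Fin m → Circ)) ℂ) ∘L R
  have hJ : DenseRange J := hd.comp hR.denseRange (ContinuousLinearMap.continuous _)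
  have htop := hJ.topologicalClosure_map_submodule
    (UnitAddTorus.span_mFourier_closure_eq_top (d := Fin m))
  rw [Submodule.topologicalClosure_eq_top_iff, Submodule.map_span, Submodule.eq_bot_iff] at htop
  have hzero := htop hf.toLp ?_
  · have h0 := Lp.eq_zero_iff_ae_eq_zero.1 hzero
    exact hf.coeFn_toLp.symm.trans h0
  rw [Submodule.mem_orthogonal]
  intro u hu
  induction hu using Submodule.span_induction with
  | zero => exact inner_zero_left _
  | add x y _ _ hx hy => rw [inner_add_left, hx, hy, add_zero]
  | smul c x _ hx => rw [inner_smul_left, hx, mul_zero]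
  | mem x hx =>
    obtain ⟨_, ⟨k, rfl⟩, rfl⟩ := hx
    rw [L2.inner_def, ← h (-k)]
    refine integral_congr_ae ?_
    filter_upwards [hf.coeFn_toLp, ContinuousMap.coeFn_toLp (p := 2) (𝕜 := ℂ)
      (volume : Measure (Fin m → Circ)) (R (UnitAddTorus.mFourier k))] with t h1 h2
    rw [h1, RCLike.inner_apply, char_neg, mul_comm]
    congr 2
    exact h2.trans (mFourier_torusHomeo k t)

end Torus

/-! ### Schwartz functions -/

section Schwartz

variable {n m : ℕ} {B : Fin m → Matrix (Fin n) (Fin n) ℝ}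

/-- A Schwartz function on `G` is its lift composed with a measurable section of
`ℝᵐ → (ℝ/2πℤ)ᵐ`. -/
theorem IsSchwartz.measurable {f : G B → ℂ} (hf : IsSchwartz f) : Measurable f := by
  let r : Circ → ℝ := fun x => (AddCircle.measurableEquivIoc (2 * Real.pi) 0 x : ℝ)
  have hr : Measurable r :=
    measurable_subtype_coe.comp (AddCircle.measurableEquivIoc (2 * Real.pi) 0).measurable
  have hr2 : ∀ x, (r x : Circ) = x := fun x =>
    (AddCircle.measurableEquivIoc (2 * Real.pi) 0).symm_apply_apply x
  have h1 : Measurable fun z : G B => lift f ((z.q, z.p), fun j => r (z.t j)) := by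
    refine hf.smooth.continuous.measurable.comp ?_
    refine (measurable_q.prodMk measurable_p).prodMk (measurable_pi_lambda _ fun j => ?_)
    exact hr.comp ((measurable_pi_apply j).comp measurable_t)
  convert h1 using 1
  funext z
  simp only [lift, hr2]

theorem IsSchwartz.norm_le {f : G B → ℂ} (hf : IsSchwartz f) (N : ℕ) :
    ∃ C : ℝ, ∀ z : G B, ‖f z‖ ≤ C * ((1 + ‖(z.q, z.p)‖) ^ N)⁻¹ := by
  have h : ∀ N, ∃ C : ℝ, ∀ z : G B, ‖(z.q, z.p)‖ ^ N * ‖f z‖ ≤ C := fun N => by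
    obtain ⟨C, hC⟩ := hf.decay N 0
    refine ⟨C, fun z => ?_⟩
    have hs : ∀ x : Circ, ∃ y : ℝ, (y : Circ) = x := fun x => QuotientAddGroup.mk_surjective x
    choose r hr using hs
    have := hC ((z.q, z.p), fun j => r (z.t j))
    rw [norm_iteratedFDeriv_zero] at this
    simpa only [lift, hr] using this
  obtain ⟨C0, h0⟩ := h 0
  obtain ⟨C1, h1⟩ := h N
  refine ⟨2 ^ (N - 1) * (C0 + C1), fun z => ?_⟩
  have hpos : 0 < (1 + ‖(z.q, z.p)‖) ^ N := by positivity
  rw [← div_eq_mul_inv, le_div_iff₀ hpos]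
  have h2 := add_pow_le zero_le_one (norm_nonneg (z.q, z.p)) N
  calc ‖f z‖ * (1 + ‖(z.q, z.p)‖) ^ N
      ≤ ‖f z‖ * (2 ^ (N - 1) * (1 ^ N + ‖(z.q, z.p)‖ ^ N)) := by gcongr
    _ = 2 ^ (N - 1) * (‖(z.q, z.p)‖ ^ 0 * ‖f z‖ + ‖(z.q, z.p)‖ ^ N * ‖f z‖) := by
        rw [one_pow, pow_zero]; ring
    _ ≤ _ := by gcongr; exacts [h0 z, h1 z]

theorem IsSchwartz.bounded {f : G B → ℂ} (hf : IsSchwartz f) : ∃ C : ℝ, ∀ z, ‖f z‖ ≤ C := by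
  obtain ⟨C, hC⟩ := hf.norm_le 0
  exact ⟨C, fun z => by simpa using hC z⟩

instance : Measure.IsAddHaarMeasure (volume : Measure (E n × E n)) :=
  inferInstanceAs (Measure.IsAddHaarMeasure
    ((volume : Measure (E n)).prod (volume : Measure (E n))))

variable (B) in
/-- The coordinates `(t, (q, p))` on `G`. -/
def torusCoords : (Fin m → Circ) × (E n × E n) → G B := fun x => ⟨x.2.1, x.2.2, x.1⟩

theorem measurable_torusCoords : Measurable (torusCoords B) :=
  measurable_mk (measurable_fst.comp measurable_snd) (measurable_snd.comp measurable_snd)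
    measurable_fst

theorem map_torusCoords :
    Measure.map (torusCoords B) (volume.prod volume) = (normConst m)⁻¹ • μ B := by
  have h1 : MeasurePreserving (fun x : (Fin m → Circ) × (E n × E n) => (x.2.1, x.2.2, x.1))
      (volume.prod volume) volume :=
    (measurePreserving_prodAssoc (volume : Measure (E n)) (volume : Measure (E n))
      (volume : Measure (Fin m → Circ))).comp Measure.measurePreserving_swap
  have h2 : torusCoords B = (coords B).symm ∘
      fun x : (Fin m → Circ) × (E n × E n) => (x.2.1, x.2.2, x.1) := rfl
  rw [h2, ← Measure.map_map (coords B).symm.measurable h1.measurable, h1.map_eq, μ, smul_smul]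
  change _ = ((normConst m)⁻¹ * normConst m) • _
  rw [ENNReal.inv_mul_cancel normConst_ne_zero normConst_ne_top, one_smul]
  rfl

theorem IsSchwartz.integrable {f : G B → ℂ} (hf : IsSchwartz f) : Integrable f (μ B) := by
  -- the exponent exceeds the dimension of `ℝⁿ × ℝⁿ`, and `𝕋ᵐ` has finite measure
  set N := Module.finrank ℝ (E n × E n) + 1 with hN
  obtain ⟨C, hC⟩ := hf.norm_le N
  have h1 : Integrable (fun y : E n × E n => C * ((1 + ‖y‖) ^ N)⁻¹) := by
    have := (integrable_one_add_norm (E := E n × E n) (μ := volume) (r := N)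
      (by rw [hN]; push_cast; linarith)).const_mul C
    refine this.congr (Filter.Eventually.of_forall fun y => ?_)
    simp only
    rw [Real.rpow_neg (by positivity), Real.rpow_natCast]
  have h2 : Integrable (fun x : (Fin m → Circ) × (E n × E n) => C * ((1 + ‖x.2‖) ^ N)⁻¹)
      (volume.prod volume) := h1.comp_snd _
  have h3 : Integrable (f ∘ torusCoords B) (volume.prod volume) :=
    h2.mono' (hf.measurable.comp measurable_torusCoords).aestronglyMeasurable
      (Filter.Eventually.of_forall fun x => hC _)
  rw [← integrable_map_measure hf.measurable.aestronglyMeasurable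
    measurable_torusCoords.aemeasurable, map_torusCoords] at h3
  exact (integrable_smul_measure (ENNReal.inv_ne_zero.2 normConst_ne_top)
    (ENNReal.inv_ne_top.2 normConst_ne_zero)).1 h3

theorem IsSchwartz.memLp {f : G B → ℂ} (hf : IsSchwartz f) : MemLp f 2 (μ B) := by
  obtain ⟨C, hC⟩ := hf.bounded
  have h : Integrable (fun z => ‖f z‖ ^ 2) (μ B) := by
    refine (hf.integrable.norm.const_mul C).mono'
      (hf.measurable.norm.pow_const 2).aestronglyMeasurable
      (Filter.Eventually.of_forall fun z => ?_)
    rw [Real.norm_of_nonneg (by positivity), sq]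
    exact mul_le_mul_of_nonneg_right (hC z) (norm_nonneg _)
  exact (memLp_two_iff_integrable_sq_norm hf.measurable.aestronglyMeasurable).2 h

variable (B) in
/-- The function `a(q, p) e^{i k·t}` on `G`. -/
def testFun (a : E n × E n → ℝ) (k : Fin m → ℤ) (z : G B) : ℂ := a (z.q, z.p) * char k z.t

/-- For smooth and compactly supported `a`, the function `a(q, p) e^{i k·t}` belongs to `S(G)`. -/
theorem isSchwartz_testFun {a : E n × E n → ℝ} (ha : ContDiff ℝ ∞ a) (hc : HasCompactSupport a)
    (k : Fin m → ℤ) : IsSchwartz (testFun B a k) := by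
  have hform : lift (testFun B a k) = fun y => (a y.1 : ℂ) *
      ∏ j, Complex.exp (2 * Real.pi * Complex.I * k j * y.2 j / (2 * Real.pi : ℝ)) := by
    funext y
    simp only [lift, testFun, char, fourier_coe_apply]
  have hsm : ContDiff ℝ ∞ (lift (testFun B a k)) := by
    rw [hform]
    refine ContDiff.mul (Complex.ofRealCLM.contDiff.comp (ha.comp contDiff_fst))
      (contDiff_prod fun j _ => ?_)
    have h1 : ContDiff ℝ ∞ fun y : (E n × E n) × (Fin m → ℝ) => ((y.2 j : ℝ) : ℂ) :=
      Complex.ofRealCLM.contDiff.comp ((contDiff_apply ℝ ℝ j).comp contDiff_snd)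
    exact ((contDiff_const.mul h1).div_const _).cexp
  refine ⟨hsm, fun N l => ?_⟩
  -- the function to be bounded is continuous, periodic in `t`, and supported over a compact set
  set H : (E n × E n) × (Fin m → ℝ) → ℝ :=
    fun y => ‖y.1‖ ^ N * ‖iteratedFDeriv ℝ l (lift (testFun B a k)) y‖ with hH
  have hcont : Continuous H :=
    (continuous_fst.norm.pow N).mul
      (hsm.continuous_iteratedFDeriv (by exact_mod_cast le_top)).norm
  have hK : IsCompact ((tsupport a) ×ˢ
      Set.Icc (0 : Fin m → ℝ) (fun _ => 2 * Real.pi)) := hc.isCompact.prod isCompact_Icc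
  obtain ⟨C, hC⟩ := hK.exists_bound_of_continuousOn hcont.continuousOn
  refine ⟨max C 0, fun y => ?_⟩
  by_cases hy : y.1 ∈ tsupport a
  -- a translation by a period moves the `t` coordinates into `[0, 2π]`
  · let s : Fin m → ℤ := fun j => toIcoDiv Real.two_pi_pos 0 (y.2 j)
    let v : Fin m → ℝ := fun j => -(s j • (2 * Real.pi))
    have hper : (fun x => lift (testFun B a k) (x + ((0 : E n × E n), v)))
        = lift (testFun B a k) := by
      funext x
      have : ∀ j, (((x.2 j + v j : ℝ)) : Circ) = (x.2 j : Circ) := fun j => by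
        have h0 : ((s j • (2 * Real.pi) : ℝ) : Circ) = 0 := by
          rw [AddCircle.coe_zsmul, AddCircle.coe_period, smul_zero]
        simp only [v, AddCircle.coe_add, AddCircle.coe_neg, h0, neg_zero, add_zero]
      simp only [lift, Prod.fst_add, Prod.snd_add, add_zero, Pi.add_apply, this]
    have hval : H (y + ((0 : E n × E n), v)) = H y := by
      simp only [hH]
      rw [← iteratedFDeriv_comp_add_right, hper]
      simp
    have hmem : y + ((0 : E n × E n), v) ∈ (tsupport a) ×ˢ
        Set.Icc (0 : Fin m → ℝ) (fun _ => 2 * Real.pi) := by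
      refine ⟨by simpa using hy, ?_⟩
      have h1 : ∀ j, y.2 j + v j ∈ Set.Ico (0 : ℝ) (0 + 2 * Real.pi) := fun j => by
        have := sub_toIcoDiv_zsmul_mem_Ico Real.two_pi_pos 0 (y.2 j)
        rwa [sub_eq_add_neg] at this
      exact ⟨fun j => (h1 j).1, fun j => by simpa using (h1 j).2.le⟩
    have := hC _ hmem
    rw [hval] at this
    exact (le_abs_self _).trans (this.trans (le_max_left _ _))
  · have h0 : iteratedFDeriv ℝ l (lift (testFun B a k)) y = 0 := by
      by_contra hne
      have h1 : y ∈ tsupport (lift (testFun B a k)) :=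
        support_iteratedFDeriv_subset l hne
      have h2 : tsupport (lift (testFun B a k)) ⊆ Prod.fst ⁻¹' tsupport a := by
        refine closure_minimal (fun x hx => subset_tsupport a ?_)
          ((isClosed_tsupport a).preimage continuous_fst)
        intro hx0
        apply hx
        simp only [lift, testFun] at hx0 ⊢
        rw [hx0, Complex.ofReal_zero, zero_mul]
      exact hy (h2 h1)
    rw [h0, norm_zero, mul_zero]
    exact le_max_right _ _

theorem memLp_sliceInner {X Y : Type*} [MeasurableSpace X] [MeasurableSpace Y] {ρ : Measure X}
    {ν : Measure Y} [SFinite ρ] [SFinite ν] (e : Lp ℂ 2 ρ) {Φ : X × Y → ℂ}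
    (hΦ : MemLp Φ 2 (ρ.prod ν)) : MemLp (sliceInner e Φ) 2 ν := by
  rw [memLp_two_iff (aestronglyMeasurable_sliceInner hΦ.1 e)]
  refine lt_of_le_of_lt (lintegral_mono_ae
    (g := fun y => ‖e‖ₑ ^ 2 * ∫⁻ x, ‖Φ (x, y)‖ₑ ^ 2 ∂ρ) ?_) ?_
  · filter_upwards [ae_memLp_slice hΦ] with y hy
    rw [sliceInner_eq_inner hy, ← enorm_toLp_sq hy, ← mul_pow]
    refine pow_le_pow_left' ?_ 2
    rw [← ofReal_norm, ← ofReal_norm, ← ofReal_norm, ← ENNReal.ofReal_mul (norm_nonneg _)]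
    exact ENNReal.ofReal_le_ofReal (norm_inner_le_norm _ _)
  · rw [lintegral_const_mul' _ _ (by simp),
      ← lintegral_prod_symm (fun z => ‖Φ z‖ₑ ^ 2) (hΦ.1.enorm.pow_const 2)]
    exact ENNReal.mul_lt_top (by simp) ((memLp_two_iff hΦ.1).1 hΦ)

/-- A square integrable function on `G` orthogonal to all `a(q, p) e^{i k·t}` vanishes: its partial
Fourier coefficients in `t` vanish almost everywhere. -/
theorem ae_eq_zero_of_integral_testFun {F : G B → ℂ} (hF : MemLp F 2 (μ B))
    (h : ∀ (a : E n × E n → ℝ) (k : Fin m → ℤ), ContDiff ℝ ∞ a → HasCompactSupport a →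
      ∫ z, F z * testFun B a k z ∂(μ B) = 0) : F =ᵐ[μ B] 0 := by
  have hmap := map_torusCoords (B := B)
  have hc0 : (normConst m)⁻¹ ≠ 0 := ENNReal.inv_ne_zero.2 normConst_ne_top
  have hct : (normConst m)⁻¹ ≠ ⊤ := ENNReal.inv_ne_top.2 normConst_ne_zero
  set Φ : (Fin m → Circ) × (E n × E n) → ℂ := F ∘ torusCoords B with hΦdef
  have hF' : MemLp F 2 (Measure.map (torusCoords B) (volume.prod volume)) := by
    rw [hmap]
    exact hF.smul_measure hct
  have hΦ : MemLp Φ 2 (volume.prod volume) :=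
    hF'.comp_of_map measurable_torusCoords.aemeasurable
  have hchar : ∀ k : Fin m → ℤ, MemLp (char k) 2 (volume : Measure (Fin m → Circ)) := fun k =>
    MemLp.of_bound (continuous_char k).aestronglyMeasurable 1
      (Filter.Eventually.of_forall fun t => (norm_char k t).le)
  let e : (Fin m → ℤ) → Lp ℂ 2 (volume : Measure (Fin m → Circ)) := fun k => (hchar (-k)).toLp
  have hslice : ∀ k y, sliceInner (e k) Φ y = ∫ t, char k t * Φ (t, y) := fun k y => by
    refine integral_congr_ae ?_
    filter_upwards [(hchar (-k)).coeFn_toLp] with t ht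
    rw [ht, char_neg, Complex.conj_conj]
  have hzero : ∀ k, ∀ᵐ y : E n × E n, sliceInner (e k) Φ y = 0 := fun k => by
    refine ae_eq_zero_of_integral_contDiff_smul_eq_zero
      ((memLp_sliceInner (e k) hΦ).locallyIntegrable (by norm_num)) fun a ha hac => ?_
    have hT := isSchwartz_testFun (B := B) ha hac k
    have hi : Integrable (fun z => F z * testFun B a k z) (μ B) := hF.integrable_mul hT.memLp
    have hi' : Integrable (fun z => F z * testFun B a k z)
        (Measure.map (torusCoords B) (volume.prod volume)) := by
      rw [hmap]
      exact hi.smul_measure hct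
    have h0 : ∫ x, F (torusCoords B x) * testFun B a k (torusCoords B x)
        ∂((volume : Measure (Fin m → Circ)).prod (volume : Measure (E n × E n))) = 0 := by
      rw [← integral_map (f := fun z => F z * testFun B a k z) measurable_torusCoords.aemeasurable
        hi'.1, hmap, integral_smul_measure, h a k ha hac, smul_zero]
    have hi2 : Integrable (fun x => F (torusCoords B x) * testFun B a k (torusCoords B x))
        ((volume : Measure (Fin m → Circ)).prod (volume : Measure (E n × E n))) :=
      hi'.comp_aemeasurable measurable_torusCoords.aemeasurable
    rw [integral_prod_symm _ hi2] at h0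
    rw [← h0]
    refine integral_congr_ae (Filter.Eventually.of_forall fun y => ?_)
    simp only [hslice]
    rw [← integral_smul]
    refine integral_congr_ae (Filter.Eventually.of_forall fun t => ?_)
    simp only [hΦdef, Function.comp_apply, testFun, torusCoords, Complex.real_smul]
    ring
  have hae : ∀ᵐ y : E n × E n, (fun t => Φ (t, y)) =ᵐ[volume] 0 := by
    filter_upwards [ae_memLp_slice hΦ, ae_all_iff.2 hzero] with y hy hy0
    exact ae_eq_zero_of_integral_char_mul hy fun k => by rw [← hslice, hy0 k]
  have hΦ0 : ∫⁻ x, ‖Φ x‖ₑ ^ 2 ∂(volume.prod volume) = 0 := by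
    rw [lintegral_prod_symm _ (hΦ.1.enorm.pow_const 2)]
    refine (lintegral_congr_ae ?_).trans lintegral_zero
    filter_upwards [hae] with y hy
    refine (lintegral_congr_ae ?_).trans lintegral_zero
    filter_upwards [hy] with t ht
    simp [ht]
  have hF0 : ∫⁻ z, ‖F z‖ₑ ^ 2 ∂(μ B) = 0 := by
    have h1 := lintegral_map' (μ := (volume : Measure (Fin m → Circ)).prod
      (volume : Measure (E n × E n))) (f := fun z => ‖F z‖ₑ ^ 2) (g := torusCoords B)
      (hF'.1.enorm.pow_const 2) measurable_torusCoords.aemeasurable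
    rw [hmap, lintegral_smul_measure] at h1
    have h2 := h1.trans hΦ0
    exact (mul_eq_zero.1 h2).resolve_left hc0
  rw [lintegral_eq_zero_iff' (hF.1.enorm.pow_const 2)] at hF0
  filter_upwards [hF0] with z hz
  simpa using hz

end Schwartz

/-! ### The Weyl transform -/

section Weyl

variable {n m : ℕ} {B : Fin m → Matrix (Fin n) (Fin n) ℝ}

/-- The indices `(k, i, j)` of the matrix coefficients `⟨e_j, π_k e_i⟩`. -/
abbrev Idx (n m : ℕ) : Type := ZStar m × onbIndex (L2R n) × onbIndex (L2R n)

instance : Countable (onbIndex (L2R n)) := countable_onbIndex_Lp _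

instance : Countable (Idx n m) :=
  have : Countable (onbIndex (L2R n) × onbIndex (L2R n)) := instCountableProd
  instCountableProd

theorem sqrt_weight_mul_self (k : ZStar m) :
    ((Real.sqrt (weight n k.1) : ℝ) : ℂ) * (Real.sqrt (weight n k.1) : ℝ) = (weight n k.1 : ℝ) := by
  rw [← Complex.ofReal_mul, Real.mul_self_sqrt (weight_pos k.2).le]

theorem weight_ne_zero (k : ZStar m) : ((weight n k.1 : ℝ) : ℂ) ≠ 0 := by
  exact_mod_cast (weight_pos (n := n) k.2).ne'

/-- The normalized matrix coefficient `√α({k}) conj ⟨e_j, π_k e_i⟩`. It is conjugated so that inner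
products with it in `L²(G)` are integrals against `⟨e_j, π_k e_i⟩`. -/
def coefFun (B : Fin m → Matrix (Fin n) (Fin n) ℝ) (a : Idx n m) (z : G B) : ℂ :=
  (Real.sqrt (weight n a.1.1) : ℝ) * conj (coef B a.1.1 (onb _ a.2.1) (onb _ a.2.2) z)

theorem memLp_coefFun (hB : IsAdmissible B) (a : Idx n m) : MemLp (coefFun B a) 2 (μ B) :=
  (memLp_conj (memLp_coef hB a.1.2 _ _)).const_mul _

/-- The normalized matrix coefficients as elements of `L²(G)`. -/
def coefVec (hB : IsAdmissible B) (a : Idx n m) : L2G B := (memLp_coefFun hB a).toLp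

theorem orthonormal_coefVec (hB : IsAdmissible B) : Orthonormal ℂ (coefVec hB) := by
  classical
  rw [orthonormal_iff_ite]
  rintro ⟨k, i, j⟩ ⟨k', i', j'⟩
  have hb := orthonormal_iff_ite.1 (onb (L2R n)).orthonormal
  have e1 : ⟪coefVec hB (k, i, j), coefVec hB (k', i', j')⟫_ℂ
      = ∫ z, ((Real.sqrt (weight n k.1) : ℝ) * (Real.sqrt (weight n k'.1) : ℝ) : ℂ) *
        (conj (coef B k'.1 (onb _ i') (onb _ j') z) * coef B k.1 (onb _ i) (onb _ j) z) ∂(μ B) := by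
    rw [L2.inner_def]
    refine integral_congr_ae ?_
    filter_upwards [(memLp_coefFun hB (k, i, j)).coeFn_toLp,
      (memLp_coefFun hB (k', i', j')).coeFn_toLp] with z h1 h2
    rw [coefVec, coefVec, h1, h2, RCLike.inner_apply]
    simp only [coefFun, map_mul, Complex.conj_conj, Complex.conj_ofReal]
    ring
  rw [e1, integral_const_mul, integral_conj_coef_mul_coef hB k'.2 k.2, hb, hb]
  by_cases hk : k = k'
  · subst hk
    rw [if_pos rfl, ← mul_assoc, sqrt_weight_mul_self, Complex.ofReal_inv,
      mul_inv_cancel₀ (weight_ne_zero k), one_mul]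
    by_cases hi : i' = i
    · by_cases hj : j = j'
      · rw [if_pos hi, if_pos hj, if_pos (by rw [hi, hj]), one_mul]
      · rw [if_neg hj, if_neg (fun h => hj (congrArg (fun a : Idx n m => a.2.2) h)), zero_mul]
    · rw [if_neg hi, if_neg (fun h => hi (congrArg (fun a : Idx n m => a.2.1) h).symm), mul_zero]
  · have hk' : k'.1 ≠ k.1 := fun h => hk (Subtype.ext h.symm)
    rw [if_neg hk', mul_zero, if_neg]
    intro h
    exact hk (Prod.ext_iff.1 h).1

/-- The weighted matrix entries `√α({k}) ⟨e_j, σ(z, k) e_i⟩` of a symbol. -/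
def entry (σ : G B × ZStar m → (L2R n →L[ℂ] L2R n)) (a : Idx n m) (z : G B) : ℂ :=
  (Real.sqrt (weight n a.1.1) : ℝ) * ⟪onb _ a.2.2, σ (z, a.1) (onb _ a.2.1)⟫_ℂ

theorem α_singleton (k : ZStar m) : α n m {k} = ENNReal.ofReal (weight n k.1) := by
  rw [α, withDensity_apply _ (measurableSet_singleton k), Measure.restrict_singleton,
    Measure.count_singleton, one_smul, lintegral_dirac]
  rfl

theorem α_singleton_ne_zero (k : ZStar m) : α n m {k} ≠ 0 := by
  rw [α_singleton]
  exact (ENNReal.ofReal_pos.2 (weight_pos k.2)).ne'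

theorem lintegral_prod_α {F : G B × ZStar m → ℝ≥0∞} (hF : AEMeasurable F ((μ B).prod (α n m))) :
    ∫⁻ x, F x ∂((μ B).prod (α n m))
      = ∑' k : ZStar m, ENNReal.ofReal (weight n k.1) * ∫⁻ z, F (z, k) ∂(μ B) := by
  rw [lintegral_prod_symm _ hF, lintegral_countable']
  refine tsum_congr fun k => ?_
  rw [α_singleton, mul_comm]

theorem aemeasurable_slice {F : G B × ZStar m → ℂ} (hF : AEMeasurable F ((μ B).prod (α n m)))
    (k : ZStar m) : AEMeasurable (fun z => F (z, k)) (μ B) := by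
  have h : ∀ᵐ k ∂(α n m), AEStronglyMeasurable (fun z => F (z, k)) (μ B) :=
    hF.aestronglyMeasurable.prod_swap.prodMk_left
  exact (ae_iff_of_countable.1 h k (α_singleton_ne_zero k)).aemeasurable

theorem aestronglyMeasurable_entry {σ : G B × ZStar m → (L2R n →L[ℂ] L2R n)}
    (hσ : MemSymbolL2 B σ) (a : Idx n m) : AEStronglyMeasurable (entry σ a) (μ B) :=
  ((aemeasurable_slice (hσ.measurable (onb _ a.2.2) (onb _ a.2.1)) a.1).const_mul
    _).aestronglyMeasurable

theorem hsNorm_sq {H : Type*} [NormedAddCommGroup H] [InnerProductSpace ℂ H] [CompleteSpace H]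
    (A : H →L[ℂ] H) : hsNorm A ^ (2 : ℝ) = hsSq A := by
  rw [hsNorm, ← ENNReal.rpow_mul]
  norm_num

/-- The norm of a symbol in terms of its matrix entries. -/
theorem lintegral_hsNorm_sq {σ : G B × ZStar m → (L2R n →L[ℂ] L2R n)} (hσ : MemSymbolL2 B σ) :
    ∫⁻ x, hsNorm (σ x) ^ (2 : ℝ) ∂((μ B).prod (α n m))
      = ∑' a : Idx n m, ∫⁻ z, ‖entry σ a z‖ₑ ^ 2 ∂(μ B) := by
  have hm : ∀ i j, AEMeasurable (fun x => ‖⟪onb (L2R n) j, σ x (onb _ i)⟫_ℂ‖ₑ ^ 2)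
      ((μ B).prod (α n m)) := fun i j => (hσ.measurable _ _).enorm.pow_const 2
  simp only [hsNorm_sq, hsSq, enorm_sq_eq_tsum (onb (L2R n)) (σ _ _)]
  rw [lintegral_tsum fun i => AEMeasurable.tsum fun j => hm i j]
  simp only [lintegral_tsum fun j => hm _ j, lintegral_prod_α (hm _ _)]
  have e : ∀ (k : ZStar m) i j, ENNReal.ofReal (weight n k.1) *
      ∫⁻ z, ‖⟪onb (L2R n) j, σ (z, k) (onb _ i)⟫_ℂ‖ₑ ^ 2 ∂(μ B)
      = ∫⁻ z, ‖entry σ (k, i, j) z‖ₑ ^ 2 ∂(μ B) := fun k i j => by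
    rw [← lintegral_const_mul' _ _ ENNReal.ofReal_ne_top]
    refine lintegral_congr fun z => ?_
    have hw : ‖((Real.sqrt (weight n k.1) : ℝ) : ℂ)‖ₑ ^ 2 = ENNReal.ofReal (weight n k.1) := by
      rw [← enorm_pow, sq, sqrt_weight_mul_self, ← ofReal_norm, Complex.norm_real,
        Real.norm_of_nonneg (weight_pos k.2).le]
    rw [entry, enorm_mul, mul_pow, hw]
  simp only [e]
  rw [ENNReal.tsum_prod (f := fun k (p : onbIndex (L2R n) × onbIndex (L2R n)) =>
      ∫⁻ z, ‖entry σ (k, p) z‖ₑ ^ 2 ∂(μ B)),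
    ← ENNReal.tsum_prod (f := fun i j => ∑' k, ∫⁻ z, ‖entry σ (k, i, j) z‖ₑ ^ 2 ∂(μ B)),
    ENNReal.tsum_comm]

theorem tsum_lintegral_entry_lt_top {σ : G B × ZStar m → (L2R n →L[ℂ] L2R n)}
    (hσ : MemSymbolL2 B σ) : ∑' a : Idx n m, ∫⁻ z, ‖entry σ a z‖ₑ ^ 2 ∂(μ B) < ⊤ := by
  rw [← lintegral_hsNorm_sq hσ]
  have h := hσ.norm_lt_top
  rw [symbolNorm] at h
  by_contra h'
  rw [not_lt, top_le_iff] at h'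
  rw [h', ENNReal.top_rpow_of_pos (by norm_num)] at h
  exact lt_irrefl _ h

/-- The function `(w, z) ↦ f(w) g(w⁻¹ z)` whose group Fourier transform in `w` is the Wigner
transform. -/
def twisted (f g : G B → ℂ) (x : G B × G B) : ℂ := f x.1 * g (x.1⁻¹ * x.2)

theorem memLp_twisted {f g : G B → ℂ} (hf : IsSchwartz f) (hg : IsSchwartz g) :
    MemLp (twisted f g) 2 ((μ B).prod (μ B)) :=
  (memLp_tensor hf.memLp hg.memLp).comp_measurePreserving
    (measurePreserving_prod_inv_mul (μ B) (μ B))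

theorem measurable_twisted {f g : G B → ℂ} (hf : IsSchwartz f) (hg : IsSchwartz g) :
    Measurable (twisted f g) :=
  (hf.measurable.comp measurable_fst).mul
    (hg.measurable.comp ((measurable_fst.inv).mul measurable_snd))

theorem integrable_mul_translate {f g : G B → ℂ} (hf : IsSchwartz f) (hg : IsSchwartz g)
    (z : G B) : Integrable (fun w => f w * translate w g z) (μ B) := by
  obtain ⟨C, hC⟩ := hg.bounded
  have hm : Measurable fun w => translate w g z :=
    hg.measurable.comp (measurable_inv.mul_const z)
  exact hf.integrable.mul_bdd (c := C) hm.aestronglyMeasurable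
    (Filter.Eventually.of_forall fun w => hC _)

theorem inner_wigner {f g : G B → ℂ} (hf : IsSchwartz f) (hg : IsSchwartz g) (z : G B)
    (k : ZStar m) (φ ψ : L2R n) :
    ⟪ψ, wigner B f g z k φ⟫_ℂ = ∫ w, twisted f g (w, z) * coef B k.1 φ ψ w ∂(μ B) :=
  inner_groupFourier B (integrable_mul_translate hf hg z) k.1 φ ψ

theorem measurable_inner_wigner {f g : G B → ℂ} (hf : IsSchwartz f) (hg : IsSchwartz g)
    (φ ψ : L2R n) :
    Measurable fun x : G B × ZStar m => ⟪ψ, wigner B f g x.1 x.2 φ⟫_ℂ := by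
  refine measurable_from_prod_countable_left fun k => ?_
  simp only [inner_wigner hf hg]
  have h : StronglyMeasurable fun x : G B × G B =>
      twisted f g (x.2, x.1) * coef B k.1 φ ψ x.2 :=
    ((measurable_twisted hf hg).comp measurable_swap).stronglyMeasurable.mul
      ((measurable_coef B k.1 φ ψ).comp measurable_snd).stronglyMeasurable
  exact (h.integral_prod_right' (ν := μ B)).measurable

/-- The matrix entries of the Wigner transform are inner products with the normalized matrix
coefficients. -/
theorem sliceInner_twisted (hB : IsAdmissible B) {f g : G B → ℂ} (hf : IsSchwartz f)
    (hg : IsSchwartz g) (a : Idx n m) (z : G B) :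
    sliceInner (coefVec hB a) (twisted f g) z
      = (Real.sqrt (weight n a.1.1) : ℝ) *
        ⟪onb _ a.2.2, wigner B f g z a.1 (onb _ a.2.1)⟫_ℂ := by
  rw [inner_wigner hf hg, ← integral_const_mul]
  refine integral_congr_ae ?_
  filter_upwards [(memLp_coefFun hB a).coeFn_toLp] with w hw
  rw [coefVec, hw]
  simp only [coefFun, map_mul, Complex.conj_conj, Complex.conj_ofReal]
  ring

/-- The terms of the expansion of `α({k}) tr[σ(z, k)* V(f, g)(z, k)]` in matrix entries: the square
roots of the weight in the two factors supply `α({k})`. -/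
def weylTerm (hB : IsAdmissible B) (σ : G B × ZStar m → (L2R n →L[ℂ] L2R n)) (f g : G B → ℂ)
    (a : Idx n m) (z : G B) : ℂ :=
  conj (entry σ a z) * sliceInner (coefVec hB a) (twisted f g) z

theorem weylIntegrand_eq_tsum_inner (σ : G B × ZStar m → (L2R n →L[ℂ] L2R n)) (f g : G B → ℂ)
    (x : G B × ZStar m) :
    weylIntegrand B σ f g x = ∑' i, ∑' j, conj ⟪onb (L2R n) j, σ x (onb _ i)⟫_ℂ *
      ⟪onb (L2R n) j, wigner B f g x.1 x.2 (onb _ i)⟫_ℂ := by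
  rw [weylIntegrand, trace]
  refine tsum_congr fun i => ?_
  rw [ContinuousLinearMap.comp_apply, ContinuousLinearMap.adjoint_inner_right,
    ← (onb (L2R n)).tsum_inner_mul_inner]
  refine tsum_congr fun j => ?_
  rw [inner_conj_symm]

theorem weight_mul_weylIntegrand (hB : IsAdmissible B)
    (σ : G B × ZStar m → (L2R n →L[ℂ] L2R n)) {f g : G B → ℂ} (hf : IsSchwartz f)
    (hg : IsSchwartz g) (z : G B) (k : ZStar m) :
    (weight n k.1 : ℝ) * weylIntegrand B σ f g (z, k)
      = ∑' i, ∑' j, weylTerm hB σ f g (k, i, j) z := by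
  rw [weylIntegrand_eq_tsum_inner, ← tsum_mul_left]
  refine tsum_congr fun i => ?_
  rw [← tsum_mul_left]
  refine tsum_congr fun j => ?_
  rw [weylTerm, sliceInner_twisted hB hf hg, entry, map_mul, Complex.conj_ofReal,
    ← sqrt_weight_mul_self]
  ring

theorem aestronglyMeasurable_weylTerm (hB : IsAdmissible B)
    {σ : G B × ZStar m → (L2R n →L[ℂ] L2R n)} (hσ : MemSymbolL2 B σ) {f g : G B → ℂ}
    (hf : IsSchwartz f) (hg : IsSchwartz g) (a : Idx n m) :
    AEStronglyMeasurable (weylTerm hB σ f g a) (μ B) :=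
  (aestronglyMeasurable_entry hσ a).star.mul
    (aestronglyMeasurable_sliceInner (memLp_twisted hf hg).1 _)

theorem lintegral_tsum_weylTerm_lt_top (hB : IsAdmissible B)
    {σ : G B × ZStar m → (L2R n →L[ℂ] L2R n)} (hσ : MemSymbolL2 B σ) {f g : G B → ℂ}
    (hf : IsSchwartz f) (hg : IsSchwartz g) :
    ∫⁻ z, ∑' a, ‖weylTerm hB σ f g a z‖ₑ ∂(μ B) < ⊤ := by
  simp only [weylTerm, enorm_mul, RCLike.enorm_conj]
  exact lintegral_tsum_slice_lt_top (orthonormal_coefVec hB) (aestronglyMeasurable_entry hσ)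
    (tsum_lintegral_entry_lt_top hσ) (memLp_twisted hf hg)

theorem aestronglyMeasurable_weylIntegrand {σ : G B × ZStar m → (L2R n →L[ℂ] L2R n)}
    (hσ : MemSymbolL2 B σ) {f g : G B → ℂ} (hf : IsSchwartz f) (hg : IsSchwartz g) :
    AEStronglyMeasurable (weylIntegrand B σ f g) ((μ B).prod (α n m)) := by
  have h : weylIntegrand B σ f g = fun x => ∑' i, ∑' j, conj ⟪onb (L2R n) j, σ x (onb _ i)⟫_ℂ *
      ⟪onb (L2R n) j, wigner B f g x.1 x.2 (onb _ i)⟫_ℂ :=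
    funext fun x => weylIntegrand_eq_tsum_inner σ f g x
  rw [h, aestronglyMeasurable_iff_aemeasurable]
  refine AEMeasurable.tsum fun i => AEMeasurable.tsum fun j => ?_
  exact (Complex.continuous_conj.measurable.comp_aemeasurable (hσ.measurable _ _)).mul
    (measurable_inner_wigner hf hg _ _).aemeasurable

theorem weight_mul_enorm_weylIntegrand_le (hB : IsAdmissible B)
    (σ : G B × ZStar m → (L2R n →L[ℂ] L2R n)) {f g : G B → ℂ} (hf : IsSchwartz f)
    (hg : IsSchwartz g) (z : G B) (k : ZStar m) :
    ENNReal.ofReal (weight n k.1) * ‖weylIntegrand B σ f g (z, k)‖ₑ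
      ≤ ∑' p : onbIndex (L2R n) × onbIndex (L2R n), ‖weylTerm hB σ f g (k, p) z‖ₑ := by
  have h : ENNReal.ofReal (weight n k.1) = ‖((weight n k.1 : ℝ) : ℂ)‖ₑ := by
    rw [← ofReal_norm, Complex.norm_real, Real.norm_of_nonneg (weight_pos k.2).le]
  rw [h, ← enorm_mul, weight_mul_weylIntegrand hB σ hf hg,
    ENNReal.tsum_prod (f := fun i j => ‖weylTerm hB σ f g (k, i, j) z‖ₑ)]
  exact enorm_tsum_le_tsum_enorm.trans (ENNReal.tsum_le_tsum fun i => enorm_tsum_le_tsum_enorm)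

theorem integrable_weylIntegrand (hB : IsAdmissible B)
    {σ : G B × ZStar m → (L2R n →L[ℂ] L2R n)} (hσ : MemSymbolL2 B σ) {f g : G B → ℂ}
    (hf : IsSchwartz f) (hg : IsSchwartz g) :
    Integrable (weylIntegrand B σ f g) ((μ B).prod (α n m)) := by
  have hm := aestronglyMeasurable_weylIntegrand hσ hf hg
  have hmT := fun a => (aestronglyMeasurable_weylTerm hB hσ hf hg a).enorm
  refine ⟨hm, ?_⟩
  rw [HasFiniteIntegral, lintegral_prod_α hm.enorm]
  refine lt_of_le_of_lt ?_ (lintegral_tsum_weylTerm_lt_top hB hσ hf hg)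
  rw [lintegral_tsum hmT, ENNReal.tsum_prod (f := fun k (p : onbIndex (L2R n) × onbIndex (L2R n)) =>
    ∫⁻ z, ‖weylTerm hB σ f g (k, p) z‖ₑ ∂(μ B))]
  refine ENNReal.tsum_le_tsum fun k => ?_
  rw [← lintegral_const_mul' _ _ ENNReal.ofReal_ne_top, ← lintegral_tsum fun p => hmT (k, p)]
  exact lintegral_mono fun z => weight_mul_enorm_weylIntegrand_le hB σ hf hg z k

theorem integral_weylIntegrand (hB : IsAdmissible B)
    {σ : G B × ZStar m → (L2R n →L[ℂ] L2R n)} (hσ : MemSymbolL2 B σ) {f g : G B → ℂ}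
    (hf : IsSchwartz f) (hg : IsSchwartz g) :
    ∫ x, weylIntegrand B σ f g x ∂((μ B).prod (α n m))
      = ∑' a, ∫ z, weylTerm hB σ f g a z ∂(μ B) := by
  have hi := integrable_weylIntegrand hB hσ hf hg
  have hmT := fun a => aestronglyMeasurable_weylTerm hB hσ hf hg a
  have hfin := lintegral_tsum_weylTerm_lt_top hB hσ hf hg
  have hfin' : ∑' a, ∫⁻ z, ‖weylTerm hB σ f g a z‖ₑ ∂(μ B) < ⊤ := by
    rwa [← lintegral_tsum fun a => (hmT a).enorm]
  have hsum : Summable fun a => ∫ z, weylTerm hB σ f g a z ∂(μ B) := by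
    refine Summable.of_norm_bounded (ENNReal.summable_toReal hfin'.ne) fun a => ?_
    rw [← toReal_enorm]
    exact ENNReal.toReal_mono (ENNReal.ne_top_of_tsum_ne_top hfin'.ne a)
      (enorm_integral_le_lintegral_enorm _)
  rw [integral_prod_symm _ hi, integral_countable hi.integral_prod_right, hsum.tsum_prod]
  refine tsum_congr fun k => ?_
  have hk : ∑' p : onbIndex (L2R n) × onbIndex (L2R n),
      ∫⁻ z, ‖weylTerm hB σ f g (k, p) z‖ₑ ∂(μ B) ≠ ⊤ := by
    rw [ENNReal.tsum_prod (f := fun k (p : onbIndex (L2R n) × onbIndex (L2R n)) =>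
      ∫⁻ z, ‖weylTerm hB σ f g (k, p) z‖ₑ ∂(μ B))] at hfin'
    exact ENNReal.ne_top_of_tsum_ne_top hfin'.ne k
  rw [Measure.real, α_singleton, ENNReal.toReal_ofReal (weight_pos k.2).le, Complex.real_smul,
    ← integral_const_mul, ← integral_tsum (fun p => hmT (k, p)) hk]
  refine integral_congr_ae ?_
  rw [← lintegral_tsum fun p => (hmT (k, p)).enorm] at hk
  filter_upwards [ae_lt_top' (AEMeasurable.tsum fun p => (hmT (k, p)).enorm) hk] with z hz
  rw [weight_mul_weylIntegrand hB σ hf hg]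
  have hs : Summable fun p : onbIndex (L2R n) × onbIndex (L2R n) =>
      weylTerm hB σ f g (k, p) z := by
    refine Summable.of_norm ((ENNReal.summable_toReal hz.ne).congr fun p => ?_)
    rw [toReal_enorm]
  rw [hs.tsum_prod]

/-- The Weyl transform exists as an integral operator. If `L = ∑ₐ eₐ ⊗ sₐ`, where the `eₐ` are the
normalized matrix coefficients and the `sₐ` the matrix entries of the symbol, its kernel is
`K(w, u) = conj (L(w, w u))`. -/
theorem exists_isWeylTransform (hB : IsAdmissible B) {σ : G B × ZStar m → (L2R n →L[ℂ] L2R n)}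
    (hσ : MemSymbolL2 B σ) :
    ∃ W : L2G B →L[ℂ] L2G B, IsWeylTransform B σ W ∧ hsNorm W = symbolNorm B σ := by
  have hfin := tsum_lintegral_entry_lt_top hσ
  have hmem : ∀ a, MemLp (entry σ a) 2 (μ B) := fun a =>
    (memLp_two_iff (aestronglyMeasurable_entry hσ a)).2
      (lt_top_iff_ne_top.2 (ENNReal.ne_top_of_tsum_ne_top hfin.ne a))
  let s : Idx n m → L2G B := fun a => (hmem a).toLp
  have hs : ∑' a, ‖s a‖ₑ ^ 2 = ∑' a, ∫⁻ z, ‖entry σ a z‖ₑ ^ 2 ∂(μ B) :=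
    tsum_congr fun a => enorm_toLp_sq (hmem a)
  have he := orthonormal_coefVec hB
  obtain ⟨L, hL, hLnorm⟩ := exists_orthogonal_sum he (s := s) (hs ▸ hfin)
  have hshear := measurePreserving_prod_mul (μ B) (μ B)
  have hK : MemLp (fun x : G B × G B => conj (L (x.1, x.1 * x.2))) 2 ((μ B).prod (μ B)) :=
    memLp_conj ((Lp.memLp L).comp_measurePreserving hshear)
  refine ⟨kernelOp hK, fun f g hf hg => ⟨integrable_weylIntegrand hB hσ hf hg, fun F hF => ?_⟩, ?_⟩
  · have hΦ := memLp_twisted hf hg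
    have h1 : HasSum (fun a => ⟪tensorLeft (coefVec hB a) (he.1 a) (s a), hΦ.toLp⟫_ℂ)
        ⟪L, hΦ.toLp⟫_ℂ := by
      have h2 := ((innerSL ℂ hΦ.toLp).hasSum hL).star
      simp only [innerSL_apply_apply] at h2
      have e : ∀ x y : Lp ℂ 2 ((μ B).prod (μ B)), star ⟪x, y⟫_ℂ = ⟪y, x⟫_ℂ :=
        fun x y => inner_conj_symm y x
      simpa only [e] using h2
    have h2 : ∀ a, ⟪tensorLeft (coefVec hB a) (he.1 a) (s a), hΦ.toLp⟫_ℂ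
        = ∫ z, weylTerm hB σ f g a z ∂(μ B) := fun a => by
      rw [inner_tensorLeft]
      refine integral_congr_ae ?_
      have hslice := sliceInner_congr_ae (coefVec hB a) hΦ.coeFn_toLp
      filter_upwards [hslice, (hmem a).coeFn_toLp] with z hz1 hz2
      rw [hz1, hz2, weylTerm]
    rw [integral_weylIntegrand hB hσ hf hg, ← tsum_congr h2, h1.tsum_eq,
      integral_kernelOp_mul hK F hg.memLp]
    have h3 : ⟪L, hΦ.toLp⟫_ℂ = ∫ x, conj (L x) * twisted f g x ∂((μ B).prod (μ B)) := by
      rw [L2.inner_def]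
      refine integral_congr_ae ?_
      filter_upwards [hΦ.coeFn_toLp] with x hx
      rw [hx, RCLike.inner_apply, mul_comm]
    -- under `(w, u) ↦ (w, w u)` the function `twisted f g` becomes `f(w) g(u)`
    rw [h3, ← hshear.integral_comp (MeasurableEquiv.shearMulRight (G B)).measurableEmbedding
      (fun x => conj (L x) * twisted f g x)]
    refine integral_congr_ae ?_
    filter_upwards [Measure.quasiMeasurePreserving_fst.ae hF] with x hx
    simp only [hx, twisted, inv_mul_cancel_left]
  · have h1 : hsSq (kernelOp hK) = ∑' a, ∫⁻ z, ‖entry σ a z‖ₑ ^ 2 ∂(μ B) := by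
      rw [hsSq_kernelOp, ← hs, ← hLnorm, enorm_Lp_sq]
      simp only [RCLike.enorm_conj]
      exact hshear.lintegral_comp_emb
        (MeasurableEquiv.shearMulRight (G B)).measurableEmbedding (fun x => ‖L x‖ₑ ^ 2)
    rw [hsNorm, h1, symbolNorm, lintegral_hsNorm_sq hσ]

/-- The Weyl transform is unique: the Schwartz functions are total in `L²(G)`. -/
theorem IsWeylTransform.unique {σ : G B × ZStar m → (L2R n →L[ℂ] L2R n)}
    {W W' : L2G B →L[ℂ] L2G B} (hW : IsWeylTransform B σ W) (hW' : IsWeylTransform B σ W') :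
    W = W' := by
  set S : Set (L2G B) := {F | ∃ f : G B → ℂ, IsSchwartz f ∧ F =ᵐ[μ B] f} with hS
  have hdense : Dense (Submodule.span ℂ S : Set (L2G B)) := by
    rw [Submodule.dense_iff_topologicalClosure_eq_top, Submodule.topologicalClosure_eq_top_iff,
      Submodule.eq_bot_iff]
    intro F hF
    rw [Lp.eq_zero_iff_ae_eq_zero]
    refine ae_eq_zero_of_integral_testFun (Lp.memLp F) fun a k ha hac => ?_
    have hT := isSchwartz_testFun (B := B) ha hac (-k)
    have h0 := (Submodule.mem_orthogonal _ _).1 hF hT.memLp.toLp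
      (Submodule.subset_span ⟨_, hT, hT.memLp.coeFn_toLp⟩)
    rw [L2.inner_def] at h0
    rw [← h0]
    refine integral_congr_ae ?_
    filter_upwards [hT.memLp.coeFn_toLp] with z hz
    rw [hz, RCLike.inner_apply, testFun, testFun, char_neg, map_mul, Complex.conj_conj,
      Complex.conj_ofReal]
  refine ContinuousLinearMap.ext_on hdense fun F hF => ?_
  obtain ⟨f, hf, hFf⟩ := hF
  rw [← sub_eq_zero, Lp.eq_zero_iff_ae_eq_zero]
  refine ae_eq_zero_of_integral_testFun (Lp.memLp _) fun a k ha hac => ?_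
  have hT := isSchwartz_testFun (B := B) ha hac k
  have h1 := (hW f _ hf hT).2 F hFf
  have h2 := (hW' f _ hf hT).2 F hFf
  have i1 : ∀ V : L2G B, Integrable (fun z => V z * testFun B a k z) (μ B) := fun V =>
    (Lp.memLp V).integrable_mul hT.memLp
  calc ∫ z, (W F - W' F) z * testFun B a k z ∂(μ B)
      = ∫ z, (W F z * testFun B a k z - W' F z * testFun B a k z) ∂(μ B) := by
        refine integral_congr_ae ?_
        filter_upwards [Lp.coeFn_sub (W F) (W' F)] with z hz
        rw [hz, Pi.sub_apply, sub_mul]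
    _ = 0 := by rw [integral_sub (i1 _) (i1 _), h1, h2, sub_self]

end Weyl

end RedHeis

end

theorem mainTheorem2 (n m : ℕ) (B : Fin m → Matrix (Fin n) (Fin n) ℝ)
    (hB : RedHeis.IsAdmissible B)
    (σ : RedHeis.G B × RedHeis.ZStar m → (RedHeis.L2R n →L[ℂ] RedHeis.L2R n))
    (hσ : RedHeis.MemSymbolL2 B σ) :
    (∃! W : RedHeis.L2G B →L[ℂ] RedHeis.L2G B, RedHeis.IsWeylTransform B σ W) ∧
    ∀ W : RedHeis.L2G B →L[ℂ] RedHeis.L2G B, RedHeis.IsWeylTransform B σ W →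
      RedHeis.IsHilbertSchmidt W ∧ RedHeis.hsNorm W = RedHeis.symbolNorm B σ := by
  obtain ⟨W, hW, hnorm⟩ := RedHeis.exists_isWeylTransform hB hσ
  refine ⟨⟨W, hW, fun W' hW' => hW'.unique hW⟩, fun W' hW' => ?_⟩
  obtain rfl := hW'.unique hW
  exact ⟨hnorm.trans_lt hσ.norm_lt_top, hnorm⟩
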